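/- **Setting.** Let $X_n$ be a finite-dimensional complex simple Lie algebra of rank $n$ with simple roots $\alpha_a$ and fundamental weights $\Lambda_a$ ($1\le a\le n$), weight lattice $P=\bigoplus_a\mathbb Z\Lambda_a$, and invariant form $(\cdot|\cdot)$ normalized so that long roots have square length $2$. Put $t_a=2/(\alpha_a|\alpha_a)\in\{1,2,3\}$, so that $C_{ab}=t_a(\alpha_a|\alpha_b)$ is the Cartan matrix and $\alpha_a=\sum_b C_{ba}\Lambda_b$. Let $x_a=e^{\Lambda_a}$, $y_a=e^{-\alpha_a}=\prod_b x_b^{-(\alpha_a|\alpha_b)t_b}$ (written $y=y(x)$), $H=\{1,\dots,n\}\times\mathbb Z_{\ge1}$, and let $\mathcal N$ be the set of families of non-negative integers indexed by $H$ with only finitely many non-zero members. **KR modules.** Let $q=e^{\hbar}\in\mathbb C^\times$ not be a root of unity, and $q^s=e^{\hbar s}$. For $(a,m)\in H$ let $W_m^{(a)}=W_m^{(a)}(u)$, $u\in\mathbb C$ (which may depend on $(a,m)$), be a Kirillov–Reshetikhin module: the irreducible finite-dimensional (type 1) module over the quantum affine algebra $U_q(X_n^{(1)})$ (without derivation) with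 Drinfeld polynomials $P_a(v)=\prod_{j=1}^m\bigl(1-v\,q^{u}q^{(m-2j+1)/t_a}\bigr)$ and $P_b(v)=1$ for $b\ne a$; it is regarded as a module over the subalgebra $U_q(X_n)$. A vector has weight $\lambda=\sum_a\lambda_a\Lambda_a$ if each Cartan generator $k_a$ acts on it by $q^{(\alpha_a|\lambda)}=q^{\lambda_a/t_a}$, and $\mathrm{ch}\,V=\sum_{\lambda\in P}\dim V_\lambda\,e^\lambda$. For $\nu=(\nu_m^{(a)})\in\mathcal N$ let $W^\nu=\bigotimes_{(a,m)\in H}(W_m^{(a)})^{\otimes\nu_m^{(a)}}$. **The series $Q_m^{(a)}$.** Let $(\tilde Q_m^{(a)}(y))_{(a,m)\in H}$ be the family of invertible power series in $\mathbb C[[y_1,\dots,y_n]]$ characterized by the $Q$-system (with $\tilde Q_0^{(a)}=1$) $$(\tilde Q_m^{(a)})^2=\tilde Q_{m+1}^{(a)}\tilde Q_{m-1}^{(a)}+y_a^m(\tilde Q_m^{(a)})^2\prod_{(b,k)\in H}(\tilde Q_k^{(b)})^{-(\alpha_a|\alpha_b)B_{am,bk}}\qquad(m\ge1),$$ $$B_{am,bk}=2\min(t_bm,t_ak)-\min(t_bm,t_a(k+1))-\min(t_bm,t_a(k-1)),$$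 together with the existence of $\lim_{m\to\infty}\tilde Q_m^{(a)}(y)$ in $\mathbb C[[y]]$ (in the adic topology, i.e. every coefficient is eventually constant) for each $a$. Put $Q_m^{(a)}(x)=x_a^m\,\tilde Q_m^{(a)}(y(x))$. **The numbers $R(\nu,N)$.** For $\nu,N\in\mathcal N$ put $$\gamma_m^{(a)}=\sum_{k\ge1}\min(m,k)\nu_k^{(a)},\qquad P_m^{(a)}=\gamma_m^{(a)}-\sum_{(b,k)\in H}(\alpha_a|\alpha_b)\min(t_bm,t_ak)N_k^{(b)},$$ $$F_{am,bk}=\delta_{ab}\delta_{mk}P_m^{(a)}+(\alpha_a|\alpha_b)\min(t_bm,t_ak)N_k^{(b)},$$ and let $R(\nu,0)=1$ and, for $N\ne0$, with $H'=\{(a,m)\in H\mid N_m^{(a)}>0\}$, $$R(\nu,N)=\Bigl(\det_{(a,m),(b,k)\in H'}F_{am,bk}\Bigr)\prod_{(a,m)\in H'}\frac1{N_m^{(a)}}\binom{P_m^{(a)}+N_m^{(a)}-1}{N_m^{(a)}-1},$$ where $\binom kj=k(k-1)\cdots(k-j+1)/j!$ for integers $k$ and $j\ge0$. Let $$\tilde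 R^\nu(y)=\sum_{N\in\mathcal N}R(\nu,N)\prod_{a=1}^n y_a^{\sum_m mN_m^{(a)}},\qquad R^\nu(x)=\Bigl(\prod_{(a,m)\in H}x_a^{m\nu_m^{(a)}}\Bigr)\tilde R^\nu(y(x)),$$ $$\mathcal N^\nu_\lambda=\Bigl\{N\in\mathcal N\ \Big|\ \sum_{(a,m)\in H}m\nu_m^{(a)}\Lambda_a-\sum_{(a,m)\in H}mN_m^{(a)}\alpha_a=\lambda\Bigr\}\qquad(\lambda\in P),$$ a finite set. **Corollary.** Assume the conjecture that $\mathrm{ch}\,W_m^{(a)}=Q_m^{(a)}(x)$ for all $(a,m)\in H$. Then for every $\nu\in\mathcal N$ $$\mathrm{ch}\,W^\nu(x)=R^\nu(x),$$ and for every weight $\lambda\in P$ $$\dim W^\nu_\lambda=\sum_{N\in\mathcal N^\nu_\lambda}R(\nu,N),$$ where $\dim W^\nu_\lambda$ is the weight multiplicity of $\lambda$ in $W^\nu$. -/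

import Mathlib

open Filter

noncomputable section

namespace KRBethe

/-! ### The Lie algebra `X_n` -/

/-- A complex finite-dimensional simple Lie algebra `X_n` of rank `n`, given by its Cartan matrix
`C` (an indecomposable Cartan matrix of finite type) and the integers
`t_a = 2 / (α_a | α_a)`, where `(· | ·)` is normalized so that long roots have square length `2`.
Thus `C_{ab} = t_a (α_a | α_b)`. -/
structure SimpleType (n : ℕ) where
  /-- the Cartan matrix -/
  C : Matrix (Fin n) (Fin n) ℤ
  /-- the integers `t_a = 2 / (α_a | α_a)` -/
  t : Fin n → ℕ
  diag : ∀ a, C a a = 2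
  off_diag : ∀ a b, a ≠ b → C a b ≤ 0
  t_pos : ∀ a, 0 < t a
  /-- the long simple roots have square length `2` -/
  exists_long : ∃ a, t a = 1
  /-- `(α_a | α_b) = C_{ab} / t_a` is symmetric -/
  symm : ∀ a b, C a b * t b = C b a * t a
  /-- finite type: the form `(α_a | α_b)` is positive definite -/
  posDef : (Matrix.of fun a b => (C a b : ℝ) / (t a : ℝ)).PosDef
  /-- the Dynkin diagram is connected -/
  indecomposable : ∀ S : Set (Fin n), S.Nonempty → Sᶜ.Nonempty → ∃ a ∈ S, ∃ b ∈ Sᶜ, C a b ≠ 0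

variable {n : ℕ}

/-- The index set `H = {(a, m) | 1 ≤ a ≤ n, m ≥ 1}`. -/
abbrev H (n : ℕ) : Type := Fin n × ℕ+

/-- The set `𝒩` of families of non-negative integers indexed by `H`, almost all zero. -/
abbrev NN (n : ℕ) : Type := H n →₀ ℕ

/-- The weight lattice `P = ⨁ ℤ Λ_a`, in the basis of the fundamental weights. -/
abbrev Weight (n : ℕ) : Type := Fin n → ℤ

namespace SimpleType

variable (D : SimpleType n)

/-- The bilinear form `(α_a | α_b) = C_{ab} / t_a`. -/
def form (a b : Fin n) : ℚ := (D.C a b : ℚ) / (D.t a : ℚ)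

/-- The simple root `α_a = ∑_b C_{ba} Λ_b`. -/
def root (a : Fin n) : Weight n := fun b => D.C b a

/-- The integer `(α_a | α_b) min (t_b m, t_a k)` (see `coe_pairing`). -/
def pairing (a : Fin n) (m : ℕ) (b : Fin n) (k : ℕ) : ℤ :=
  if D.t b * m ≤ D.t a * k then D.C b a * m else D.C a b * k

theorem coe_pairing (a : Fin n) (m : ℕ) (b : Fin n) (k : ℕ) :
    (D.pairing a m b k : ℚ) = D.form a b * min ((D.t b : ℚ) * m) ((D.t a : ℚ) * k) := by
  have ha : (D.t a : ℚ) ≠ 0 := by exact_mod_cast (D.t_pos a).ne'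
  have hs : (D.C a b : ℚ) * D.t b = D.C b a * D.t a := by exact_mod_cast D.symm a b
  unfold pairing form
  split_ifs with h
  · have h' : (D.t b : ℚ) * m ≤ (D.t a : ℚ) * k := by exact_mod_cast h
    rw [min_eq_left h']
    push_cast
    field_simp
    linear_combination (-(m : ℚ)) * hs
  · have h' : (D.t a : ℚ) * k ≤ (D.t b : ℚ) * m := by exact_mod_cast (not_le.mp h).le
    rw [min_eq_right h']
    push_cast
    field_simp

/-- `B_{am,bk} = 2 min (t_b m, t_a k) - min (t_b m, t_a (k+1)) - min (t_b m, t_a (k-1))`,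
for `k ≥ 1`. -/
def B (a : Fin n) (m : ℕ) (b : Fin n) (k : ℕ) : ℤ :=
  2 * ((min (D.t b * m) (D.t a * k) : ℕ) : ℤ) - ((min (D.t b * m) (D.t a * (k + 1)) : ℕ) : ℤ)
    - ((min (D.t b * m) (D.t a * (k - 1)) : ℕ) : ℤ)

/-- The integer `(α_a | α_b) B_{am,bk}`, for `k ≥ 1` (see `coe_expB`). -/
def expB (a : Fin n) (m : ℕ) (b : Fin n) (k : ℕ) : ℤ :=
  2 * D.pairing a m b k - D.pairing a m b (k + 1) - D.pairing a m b (k - 1)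

theorem coe_expB (a : Fin n) (m : ℕ) (b : Fin n) (k : ℕ) :
    (D.expB a m b k : ℚ) = D.form a b * D.B a m b k := by
  unfold expB B
  push_cast [coe_pairing]
  ring

/-- For given `(a, m)` there are only finitely many `(b, k)` with `(α_a | α_b) B_{am,bk} ≠ 0`. -/
theorem finite_expB (a : Fin n) (m : ℕ) :
    {p : H n | D.expB a m p.1 p.2 ≠ 0}.Finite := by
  have hfin : ((Set.univ : Set (Fin n)) ×ˢ
      (⋃ b : Fin n, {k : ℕ+ | (k : ℕ) ≤ D.t b * m + 1})).Finite := by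
    refine Set.finite_univ.prod (Set.finite_iUnion fun b => ?_)
    refine ((Set.finite_Iic (D.t b * m + 1)).preimage
      (f := fun k : ℕ+ => (k : ℕ)) ?_)
    exact fun x _ y _ h => PNat.coe_injective h
  refine hfin.subset ?_
  rintro ⟨b, k⟩ h
  refine ⟨trivial, Set.mem_iUnion.mpr ⟨b, ?_⟩⟩
  by_contra hk
  apply h
  have hk' : D.t b * m + 1 < (k : ℕ) := not_le.mp hk
  have ha := D.t_pos a
  have key : ∀ j : ℕ, D.t b * m ≤ j → D.pairing a m b j = D.C b a * m := by
    intro j hj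
    unfold pairing
    rw [if_pos]
    nlinarith
  have h1 := key k (by omega)
  have h2 := key (k + 1) (by omega)
  have h3 := key (k - 1) (by omega)
  simp only [expB, h1, h2, h3]
  ring

/-! ### The `Q`-system -/

/-- A family `(Q̃_m^{(a)}(y))`, `m ≥ 0`, of invertible power series in `y = (y_1, …, y_n)` with
`Q̃_0^{(a)} = 1` that satisfies the `Q`-system and converges as `m → ∞` for the standard (adic)
topology of `ℂ[[y]]`, i.e. every coefficient is eventually constant. -/
structure IsQFamily (Q : Fin n → ℕ → (MvPowerSeries (Fin n) ℂ)ˣ) : Prop where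
  zero : ∀ a, Q a 0 = 1
  rel : ∀ a (m : ℕ), 1 ≤ m →
    (Q a m : MvPowerSeries (Fin n) ℂ) ^ 2 =
      (Q a (m + 1) : MvPowerSeries (Fin n) ℂ) * (Q a (m - 1) : MvPowerSeries (Fin n) ℂ) +
        MvPowerSeries.X a ^ m * (Q a m : MvPowerSeries (Fin n) ℂ) ^ 2 *
          ((∏ᶠ p : H n, Q p.1 p.2 ^ (-(D.expB a m p.1 p.2)) : (MvPowerSeries (Fin n) ℂ)ˣ) :
            MvPowerSeries (Fin n) ℂ)
  conv : ∀ a, ∃ L : MvPowerSeries (Fin n) ℂ, ∀ d : Fin n →₀ ℕ, ∀ᶠ m : ℕ in atTop,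
    MvPowerSeries.coeff d (Q a m : MvPowerSeries (Fin n) ℂ) = MvPowerSeries.coeff d L

/-! ### The numbers `R(ν, N)` and their generating series -/

/-- `γ_m^{(a)}(ν) = ∑_k min (m, k) ν_k^{(a)}`. -/
def gam (ν : NN n) (p : H n) : ℤ :=
  ν.sum fun r c => if r.1 = p.1 then ((min (p.2 : ℕ) (r.2 : ℕ) : ℕ) : ℤ) * c else 0

/-- `P_m^{(a)}(ν, N) = γ_m^{(a)}(ν) - ∑_{(b,k)} (α_a | α_b) min (t_b m, t_a k) N_k^{(b)}`. -/
def vac (ν N : NN n) (p : H n) : ℤ :=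
  gam ν p - N.sum fun r c => D.pairing p.1 p.2 r.1 r.2 * c

/-- The matrix
`F_{am,bk} = δ_{ab} δ_{mk} P_m^{(a)} + (α_a | α_b) min (t_b m, t_a k) N_k^{(b)}`. -/
def F (ν N : NN n) (p r : H n) : ℤ :=
  (if p = r then D.vac ν N p else 0) + D.pairing p.1 p.2 r.1 r.2 * N r

/-- `R(ν, N) = det_{H'} F ∏_{H'} (1 / N_m^{(a)}) binom (P_m^{(a)} + N_m^{(a)} - 1) (N_m^{(a)} - 1)`,
where `H' = {(a, m) | N_m^{(a)} > 0}` is the support of `N`, and `R(ν, 0) = 1`. -/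
def R (ν N : NN n) : ℚ :=
  if N = 0 then 1 else
    ((Matrix.det (Matrix.of fun p r : N.support => D.F ν N p r) : ℤ) : ℚ) *
      ∏ p ∈ N.support,
        (1 / (N p : ℚ)) * ((Ring.choose (D.vac ν N p + N p - 1) (N p - 1) : ℤ) : ℚ)

/-- The exponents `(∑_m m N_m^{(a)})_a`. -/
def content (N : NN n) : Fin n →₀ ℕ :=
  N.sum fun p c => Finsupp.single p.1 ((p.2 : ℕ) * c)

/-- There are finitely many `N ∈ 𝒩` with given exponents `(∑_m m N_m^{(a)})_a`. -/
theorem finite_content (d : Fin n →₀ ℕ) : {N : NN n | content N = d}.Finite := by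
  classical
  -- each `m N_m^{(a)}` is at most `d_a`
  have key : ∀ N : NN n, content N = d → ∀ p : H n, (p.2 : ℕ) * N p ≤ d p.1 := by
    intro N hN p
    by_cases hp : N p = 0
    · simp [hp]
    have hmem : p ∈ N.support := Finsupp.mem_support_iff.mpr hp
    have h1 : d p.1 = ∑ r ∈ N.support, (Finsupp.single r.1 ((r.2 : ℕ) * N r)) p.1 := by
      rw [← hN, content, Finsupp.sum, Finsupp.finsetSum_apply]
    rw [h1]
    have h2 := Finset.single_le_sum
      (f := fun r : H n => (Finsupp.single r.1 ((r.2 : ℕ) * N r)) p.1)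
      (fun _ _ => Nat.zero_le _) hmem
    simpa using h2
  have hS : {p : H n | (p.2 : ℕ) ≤ d p.1}.Finite := by
    have hfin : ((Set.univ : Set (Fin n)) ×ˢ
        (⋃ b : Fin n, {k : ℕ+ | (k : ℕ) ≤ d b})).Finite := by
      refine Set.finite_univ.prod (Set.finite_iUnion fun b => ?_)
      refine ((Set.finite_Iic (d b)).preimage (f := fun k : ℕ+ => (k : ℕ)) ?_)
      exact fun x _ y _ h => PNat.coe_injective h
    exact hfin.subset fun p hp => ⟨trivial, Set.mem_iUnion.mpr ⟨p.1, hp⟩⟩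
  let b : NN n := Finsupp.onFinset hS.toFinset (fun p => if (p.2 : ℕ) ≤ d p.1 then d p.1 else 0)
    (by
      intro p hp
      simp only [Set.Finite.mem_toFinset, Set.mem_ofPred_eq]
      by_contra hc
      simp [hc] at hp)
  refine (Set.finite_Iic b).subset fun N hN p => ?_
  have hk := key N hN p
  have hp1 : 1 ≤ (p.2 : ℕ) := p.2.2
  change N p ≤ if (p.2 : ℕ) ≤ d p.1 then d p.1 else 0
  split_ifs with h
  · nlinarith
  · by_contra hc
    have : 1 ≤ N p := by omega
    nlinarith

/-- The power series `R̃^ν(y) = ∑_{N ∈ 𝒩} R(ν, N) ∏_a y_a ^ (∑_m m N_m^{(a)})`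
(each coefficient is a finite sum, by `finite_content`). -/
def Rtilde (ν : NN n) : MvPowerSeries (Fin n) ℂ :=
  fun d => ∑ᶠ N ∈ {N : NN n | content N = d}, ((D.R ν N : ℚ) : ℂ)

/-- The Laurent series `e^μ f(y(x))` in `x_a = e^{Λ_a}`, where `y_a = e^{-α_a}`, given by its
coefficients: the coefficient of `e^λ` is the coefficient of `y^d` in `f` for the exponent `d`
(unique, if it exists, as the simple roots are linearly independent) with
`μ - ∑_a d_a α_a = λ`. -/
def laurent (μ : Weight n) (f : MvPowerSeries (Fin n) ℂ) (lam : Weight n) : ℂ :=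
  ∑ᶠ d ∈ {d : Fin n →₀ ℕ | μ - ∑ a, d a • D.root a = lam}, MvPowerSeries.coeff d f

/-- The weight `∑_{(a,m)} m ν_m^{(a)} Λ_a`. -/
def topWeight (ν : NN n) : Weight n := fun a => (content ν a : ℤ)

/-- The Laurent series `R^ν(x) = (∏ x_a ^ (m ν_m^{(a)})) R̃^ν(y(x))`. -/
def Rx (ν : NN n) : Weight n → ℂ := D.laurent (topWeight ν) (D.Rtilde ν)

/-- The set `𝒩^ν_λ` of the `N ∈ 𝒩` with `∑ m ν_m^{(a)} Λ_a - ∑ m N_m^{(a)} α_a = λ`. -/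
def NNset (ν : NN n) (lam : Weight n) : Set (NN n) :=
  {N | topWeight ν - ∑ a, content N a • D.root a = lam}

/-- The simple roots are linearly independent. -/
theorem root_injective (d e : Fin n →₀ ℕ)
    (h : ∑ a, d a • D.root a = ∑ a, e a • D.root a) : d = e := by
  classical
  have hdet := D.posDef.isUnit
  let M : Matrix (Fin n) (Fin n) ℝ := Matrix.of fun a b => (D.C a b : ℝ) / (D.t a : ℝ)
  have hinj : Function.Injective M.mulVec := Matrix.mulVec_injective_iff_isUnit.mpr hdet
  have hv : M.mulVec (fun a => (d a : ℝ)) = M.mulVec (fun a => (e a : ℝ)) := by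
    funext b
    have hb := congrFun h b
    simp only [Finset.sum_apply, Pi.smul_apply, root, nsmul_eq_mul] at hb
    have hb' : ∑ a, (d a : ℝ) * D.C b a = ∑ a, (e a : ℝ) * D.C b a := by exact_mod_cast hb
    simp only [Matrix.mulVec, dotProduct, M, Matrix.of_apply]
    have e1 : ∀ f : Fin n →₀ ℕ, ∑ a, (D.C b a : ℝ) / (D.t b : ℝ) * (f a : ℝ)
        = (∑ a, (f a : ℝ) * D.C b a) / (D.t b : ℝ) := by
      intro f
      rw [Finset.sum_div]
      exact Finset.sum_congr rfl fun a _ => by ring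
    rw [e1, e1, hb']
  have := hinj hv
  ext a
  exact_mod_cast congrFun this a

/-- The set `𝒩^ν_λ` is finite. -/
theorem finite_NNset (ν : NN n) (lam : Weight n) : (D.NNset ν lam).Finite := by
  rcases (D.NNset ν lam).eq_empty_or_nonempty with h | ⟨N₀, h₀⟩
  · rw [h]; exact Set.finite_empty
  · refine (finite_content (content N₀)).subset fun N hN => D.root_injective _ _ ?_
    have h1 : topWeight ν - ∑ a, content N a • D.root a = lam := hN
    have h2 : topWeight ν - ∑ a, content N₀ a • D.root a = lam := h₀
    exact sub_right_injective (h1.trans h2.symm)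

end SimpleType

/-! ### The quantum affine algebra `U_q(X_n^{(1)})` -/

/-- The power `q ^ s` for `q = exp ℏ`. -/
def qpow (hbar s : ℂ) : ℂ := Complex.exp (hbar * s)

/-- The quantum integer `[r]_z = (z^r - z^{-r}) / (z - z^{-1})`. -/
def qint (z : ℂ) (r : ℤ) : ℂ := (z ^ r - z ^ (-r)) / (z - z⁻¹)

/-- The quantum factorial `[m]_z!`. -/
def qfact (z : ℂ) (m : ℕ) : ℂ := ∏ j ∈ Finset.range m, qint z (j + 1)

/-- The quantum binomial coefficient. -/
def qbinom (z : ℂ) (s k : ℕ) : ℂ := qfact z s / (qfact z k * qfact z (s - k))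

/-- Signs: `true` is `+`, `false` is `-`. -/
def sgn (s : Bool) : ℤ := if s then 1 else -1

/-- Drinfeld's generators of `U_q(X_n^{(1)})` (without derivation): `x^±_{i,r}` with `r ∈ ℤ`,
`h_{i,±m}` with `m ≥ 1`, `k_i^{±1}`, and `c^{±1/2}`. -/
inductive Gen (n : ℕ) : Type
  | x (s : Bool) (i : Fin n) (r : ℤ)
  | h (s : Bool) (i : Fin n) (m : ℕ+)
  | k (s : Bool) (i : Fin n)
  | c (s : Bool)

/-- The free algebra on Drinfeld's generators. -/
abbrev FreeGen (n : ℕ) : Type := FreeAlgebra ℂ (Gen n)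

namespace FreeGen

/-- The generator `x^±_{i,r}`. -/
def x (s : Bool) (i : Fin n) (r : ℤ) : FreeGen n := FreeAlgebra.ι ℂ (Gen.x s i r)

/-- The generator `h_{i,±m}`. -/
def h (s : Bool) (i : Fin n) (m : ℕ+) : FreeGen n := FreeAlgebra.ι ℂ (Gen.h s i m)

/-- The generator `k_i^{±1}`. -/
def k (s : Bool) (i : Fin n) : FreeGen n := FreeAlgebra.ι ℂ (Gen.k s i)

/-- The generator `c^{±1/2}`. -/
def c (s : Bool) : FreeGen n := FreeAlgebra.ι ℂ (Gen.c s)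

/-- The power `c^{r/2}`, `r ∈ ℤ`. -/
def cpow (r : ℤ) : FreeGen n := c (decide (0 ≤ r)) ^ r.natAbs

end FreeGen

namespace SimpleType

variable (D : SimpleType n) (hbar : ℂ)

/-- `q_i = q^{(α_i | α_i) / 2} = q^{1 / t_i}`. -/
def qi (i : Fin n) : ℂ := qpow hbar (1 / (D.t i : ℂ))

/-- The series `± (q_i - q_i^{-1}) ∑_{m ≥ 1} h_{i,±m} w^m`. -/
def hSeries (s : Bool) (i : Fin n) : PowerSeries (FreeGen n) :=
  PowerSeries.mk fun m =>
    if hm : 0 < m then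
      ((sgn s : ℂ) * (D.qi hbar i - (D.qi hbar i)⁻¹)) • FreeGen.h s i ⟨m, hm⟩
    else 0

/-- The element `φ^±_{i,±m}`, `m ≥ 0`: the coefficient of `w^m` in
`k_i^{±1} exp (± (q_i - q_i^{-1}) ∑_{m ≥ 1} h_{i,±m} w^m)`. In this coefficient only the powers
of the exponent up to the `m`-th matter, its constant term being zero. -/
def phi (s : Bool) (i : Fin n) (m : ℕ) : FreeGen n :=
  FreeGen.k s i * ∑ j ∈ Finset.range (m + 1),
    ((1 : ℂ) / (j.factorial : ℂ)) • PowerSeries.coeff m (D.hSeries hbar s i ^ j)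

/-- The element `φ^±_{i,r}`, `r ∈ ℤ`, which is zero if `± r < 0`. -/
def phiZ (s : Bool) (i : Fin n) (r : ℤ) : FreeGen n :=
  if 0 ≤ sgn s * r then D.phi hbar s i (sgn s * r).toNat else 0

/-- The product `x^±_{i,r_1} ⋯ x^±_{i,r_k} x^±_{j,p} x^±_{i,r_{k+1}} ⋯ x^±_{i,r_l}` for the list
`r` of length `l`. -/
def serreWord (s : Bool) (i j : Fin n) (p : ℤ) (r : List ℤ) (k : ℕ) : FreeGen n :=
  ((r.take k).map (FreeGen.x s i)).prod * FreeGen.x s j p *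
    ((r.drop k).map (FreeGen.x s i)).prod

/-- The defining relations of Drinfeld's realization of `U_q(X_n^{(1)})`. -/
inductive Rel : FreeGen n → FreeGen n → Prop
  | c_inv (s : Bool) : Rel (FreeGen.c s * FreeGen.c (!s)) 1
  | c_central (s : Bool) (g : Gen n) :
      Rel (FreeGen.c s * FreeAlgebra.ι ℂ g) (FreeAlgebra.ι ℂ g * FreeGen.c s)
  | k_inv (s : Bool) (i : Fin n) : Rel (FreeGen.k s i * FreeGen.k (!s) i) 1
  | k_k (i j : Fin n) :
      Rel (FreeGen.k true i * FreeGen.k true j) (FreeGen.k true j * FreeGen.k true i)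
  | k_h (i : Fin n) (s : Bool) (j : Fin n) (m : ℕ+) :
      Rel (FreeGen.k true i * FreeGen.h s j m) (FreeGen.h s j m * FreeGen.k true i)
  | k_x (i : Fin n) (s : Bool) (j : Fin n) (r : ℤ) :
      Rel (FreeGen.k true i * FreeGen.x s j r * FreeGen.k false i)
        (D.qi hbar i ^ (sgn s * D.C i j) • FreeGen.x s j r)
  | h_h_same (s : Bool) (i j : Fin n) (m m' : ℕ+) :
      Rel (FreeGen.h s i m * FreeGen.h s j m' - FreeGen.h s j m' * FreeGen.h s i m) 0
  | h_h_opp (i j : Fin n) (m m' : ℕ+) :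
      Rel (FreeGen.h true i m * FreeGen.h false j m' - FreeGen.h false j m' * FreeGen.h true i m)
        (if m = m' then
          ((1 : ℂ) / ((m : ℕ) : ℂ) * qint (D.qi hbar i) ((m : ℕ) * D.C i j) /
              (D.qi hbar j - (D.qi hbar j)⁻¹)) •
            (FreeGen.cpow (2 * (m : ℕ)) - FreeGen.cpow (-(2 * (m : ℕ))))
        else 0)
  | h_x (s' : Bool) (i : Fin n) (m : ℕ+) (s : Bool) (j : Fin n) (r : ℤ) :
      Rel (FreeGen.h s' i m * FreeGen.x s j r - FreeGen.x s j r * FreeGen.h s' i m)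
        (((sgn s : ℂ) / ((m : ℕ) : ℂ) * qint (D.qi hbar i) ((m : ℕ) * D.C i j)) •
          (FreeGen.cpow (-(sgn s * (m : ℕ))) * FreeGen.x s j (r + sgn s' * (m : ℕ))))
  | x_x (s : Bool) (i j : Fin n) (r p : ℤ) :
      Rel
        (FreeGen.x s i (r + 1) * FreeGen.x s j p -
          D.qi hbar i ^ (sgn s * D.C i j) • (FreeGen.x s j p * FreeGen.x s i (r + 1)))
        (D.qi hbar i ^ (sgn s * D.C i j) • (FreeGen.x s i r * FreeGen.x s j (p + 1)) -
          FreeGen.x s j (p + 1) * FreeGen.x s i r)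
  | xp_xm (i j : Fin n) (r p : ℤ) :
      Rel (FreeGen.x true i r * FreeGen.x false j p - FreeGen.x false j p * FreeGen.x true i r)
        (if i = j then
          ((1 : ℂ) / (D.qi hbar i - (D.qi hbar i)⁻¹)) •
            (FreeGen.cpow (r - p) * D.phiZ hbar true i (r + p) -
              FreeGen.cpow (-(r - p)) * D.phiZ hbar false i (r + p))
        else 0)
  | serre (s : Bool) (i j : Fin n) (hij : i ≠ j) (p : ℤ) (r : Fin (1 - D.C i j).toNat → ℤ) :
      Rel
        (∑ π : Equiv.Perm (Fin (1 - D.C i j).toNat),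
          ∑ k ∈ Finset.range ((1 - D.C i j).toNat + 1),
            ((-1 : ℂ) ^ k * qbinom (D.qi hbar i) (1 - D.C i j).toNat k) •
              serreWord s i j p (List.ofFn fun l => r (π l)) k) 0

/-- The quantum affine algebra `U_q(X_n^{(1)})`, `q = exp ℏ`, without derivation. -/
abbrev QAffine : Type := RingQuot (D.Rel hbar)

/-- The class in `U_q(X_n^{(1)})` of an element of the free algebra on the generators. -/
def cls : FreeGen n →ₐ[ℂ] D.QAffine hbar := RingQuot.mkAlgHom ℂ (D.Rel hbar)

section Modules

variable (V : Type*) [AddCommGroup V] [Module ℂ V] [Module (D.QAffine hbar) V]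
  [IsScalarTower ℂ (D.QAffine hbar) V]

/-- `V` is an irreducible finite-dimensional `U_q(X_n^{(1)})`-module (of type 1) with Drinfeld
polynomials `(P_b)`: it contains a vector `v ≠ 0` with `x^+_{b,r} v = 0`, `c^{1/2} v = v` and
`φ^±_{b,±m} v = ψ^±_{b,±m} v`, where `∑_m ψ^+_{b,m} w^m` and `∑_m ψ^-_{b,-m} w^{-m}` are the
expansions at `w = 0` and `w = ∞` of `q_b^{deg P_b} P_b(w q_b^{-1}) / P_b(w q_b)`. (At `w = ∞`,
numerator and denominator are both multiplied by `w^{- deg P_b}`, which gives the reversed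
polynomials in `w^{-1}`.) -/
structure HasDrinfeldPolynomials (P : Fin n → Polynomial ℂ) : Prop where
  finite : FiniteDimensional ℂ V
  irreducible : IsSimpleModule (D.QAffine hbar) V
  exists_vector : ∃ v : V, v ≠ 0 ∧ D.cls hbar (FreeGen.c true) • v = v ∧
    (∀ b r, D.cls hbar (FreeGen.x true b r) • v = 0) ∧
    ∃ ψ : Bool → Fin n → PowerSeries ℂ,
      (∀ s b m, D.cls hbar (D.phi hbar s b m) • v = (PowerSeries.coeff m (ψ s b)) • v) ∧
      (∀ b, ψ true b *
          (((P b).comp (Polynomial.C (D.qi hbar b) * Polynomial.X) : Polynomial ℂ) :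
            PowerSeries ℂ) =
        (D.qi hbar b ^ (P b).natDegree) •
          (((P b).comp (Polynomial.C (D.qi hbar b)⁻¹ * Polynomial.X) : Polynomial ℂ) :
            PowerSeries ℂ)) ∧
      (∀ b, ψ false b *
          (((P b).comp (Polynomial.C (D.qi hbar b) * Polynomial.X)).reverse : PowerSeries ℂ) =
        (D.qi hbar b ^ (P b).natDegree) •
          (((P b).comp (Polynomial.C (D.qi hbar b)⁻¹ * Polynomial.X)).reverse : PowerSeries ℂ))

/-- The Drinfeld polynomials of the KR module `W_m^{(a)}(u)`:
`P_a(v) = ∏_{j=1}^m (1 - v q^u q^{(m-2j+1)/t_a})`, and `P_b(v) = 1` for `b ≠ a`. -/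
def krPoly (a : Fin n) (m : ℕ) (u : ℂ) (b : Fin n) : Polynomial ℂ :=
  if b = a then
    ∏ j ∈ Finset.Icc 1 m, (1 - Polynomial.C
      (qpow hbar u * qpow hbar (((m : ℂ) - 2 * (j : ℂ) + 1) / (D.t a : ℂ))) * Polynomial.X)
  else 1

/-- `V` is a Kirillov–Reshetikhin module `W_m^{(a)}(u)`. -/
def IsKRModule (a : Fin n) (m : ℕ) (u : ℂ) : Prop :=
  D.HasDrinfeldPolynomials hbar V (D.krPoly hbar a m u)

/-- The action of the Cartan element `k_i` of `U_q(X_n) ⊆ U_q(X_n^{(1)})` on `V`. -/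
def kAct (i : Fin n) : Module.End ℂ V :=
  Algebra.lsmul ℂ ℂ V (D.cls hbar (FreeGen.k true i))

end Modules

/-- The weight space of weight `λ = ∑ λ_i Λ_i` for operators `k_1, …, k_n`: the vectors on which
every `k_i` acts as `q^{(α_i | λ)} = q^{λ_i / t_i}`. -/
def weightSpace {V : Type*} [AddCommGroup V] [Module ℂ V] (K : Fin n → Module.End ℂ V)
    (lam : Weight n) : Submodule ℂ V :=
  ⨅ i, (K i).eigenspace (qpow hbar ((lam i : ℂ) / (D.t i : ℂ)))

/-- The weight multiplicity of `λ`. -/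
def weightMult {V : Type*} [AddCommGroup V] [Module ℂ V] (K : Fin n → Module.End ℂ V)
    (lam : Weight n) : ℕ :=
  Module.finrank ℂ (D.weightSpace hbar K lam)

/-- The character `∑_λ (dim V_λ) e^λ`, as a formal sum given by its coefficients. -/
def character {V : Type*} [AddCommGroup V] [Module ℂ V] (K : Fin n → Module.End ℂ V) :
    Weight n → ℂ :=
  fun lam => (D.weightMult hbar K lam : ℂ)

section Tensor

variable (W : Fin n → ℕ+ → Type*) [∀ a m, AddCommGroup (W a m)] [∀ a m, Module ℂ (W a m)]

/-- The tensor product `W^ν = ⨂_{(a,m)} (W_m^{(a)})^{⊗ ν_m^{(a)}}`. -/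
abbrev TensorW (ν : NN n) : Type _ :=
  PiTensorProduct ℂ fun j : (Σ p : ν.support, Fin (ν p)) => W j.1.1.1 j.1.1.2

/-- The action of `k_i ∈ U_q(X_n)` on `W^ν`. The `k_i` are group-like, `Δ(k_i) = k_i ⊗ k_i`, so
`k_i` acts as `k_i ⊗ ⋯ ⊗ k_i`. -/
def kActTensor [∀ a m, Module (D.QAffine hbar) (W a m)]
    [∀ a m, IsScalarTower ℂ (D.QAffine hbar) (W a m)] (ν : NN n) (i : Fin n) :
    Module.End ℂ (TensorW W ν) :=
  PiTensorProduct.map fun j : (Σ p : ν.support, Fin (ν p)) =>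
    D.kAct hbar (W j.1.1.1 j.1.1.2) i

end Tensor

end SimpleType

end KRBethe

end

/-! The heart is the power series identity `∏ Q̃ ^ ν = R̃^ν`, proved modulo degree `> M` for every
`M`. Put `v_m = Q_{m+1} Q_{m-1} / Q_m²`. Convergence makes `Q_m` stationary modulo high degree, so
summation by parts inverts this relation: `Q_m = ∏_k v_k ^ (-min(m,k))`. The Q-system becomes `v_p =
1 - w_p ∏_r v_r ^ G_{pr}`, where `w_{(a,m)} = y_a^m` and `G` is the symmetric matrix `(α_a|α_b)
min(t_b m, t_a k)`. As `v_m = 1` for `m > M`, only finitely many indices remain, and the task is to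
expand `∏ v ^ (-γ)` in `w`: multivariate Lagrange inversion.

This inversion is done by a recurrence. The function `f(γ) = ∏ v ^ (-γ)` satisfies `f(0) = 1` and
`f(γ) - f(γ - e_p) = w_p f(γ - G_p)`, which determine it because multiplication by `w_p` raises the
degree (`eq_zero_of_recurrence`). The candidate coefficients are determinants; they obey the same
recurrence by Pascal's rule in one column (`lagCoeff_add_single`), and they give `f(0) = 1` because
the rows of `F` sum to zero at `γ = 0` (`lagCoeff_zero_left`). Extracting column factors identifies
them with `R(ν, N)` (`lagCoeff_eq_det`, `R_embDomain`).

On the module side, irreducibility gives each KR module a basis of weight vectors. The `k_i` act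
diagonally on tensors of such vectors, so characters multiply. As `q` is not a root of unity,
weights are separated by eigenvalues; as simple roots are independent, characters and power series
determine each other. -/

open Filter

noncomputable section

namespace KRBethe

/-! ### Lagrange inversion coefficients as determinants -/

section Lagrange

variable {ι : Type*} [Fintype ι] [DecidableEq ι] (G : ι → ι → ℤ)

/-- The shifted exponent `γ_r - ∑_s N_s G_{sr}`. -/
def lagVac (γ : ι → ℤ) (N : ι →₀ ℕ) (r : ι) : ℤ := γ r - ∑ s, (N s : ℤ) * G s r

/-- The coefficient of `z ^ N` in `(1 - z) ^ (-P) * (δ + g * z / (1 - z))`. -/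
def lagEntry (δ g P : ℤ) : ℕ → ℤ
  | 0 => δ
  | k + 1 => δ * Ring.multichoose P (k + 1) + g * Ring.multichoose (P + 1) k

/-- Multiplying the generating function `(1 - z) ^ (-P) * (δ + g z / (1 - z))` by `1 - z` replaces
`P` by `P - 1`; compare coefficients of `z ^ (k + 1)`. -/
theorem lagEntry_sub (δ g P : ℤ) (k : ℕ) :
    lagEntry δ g P (k + 1) = lagEntry δ g (P - 1) (k + 1) + lagEntry δ g P k := by
  have h1 := Ring.multichoose_succ_succ (P - 1) k
  have h2 : ∀ j, Ring.multichoose (P + 1) (j + 1) =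
      Ring.multichoose P (j + 1) + Ring.multichoose (P + 1) j := Ring.multichoose_succ_succ P
  rw [sub_add_cancel] at h1
  cases k with
  | zero => simp [lagEntry]; ring
  | succ k =>
    simp only [lagEntry, sub_add_cancel]
    rw [h1, h2 k]
    ring

/-- The matrix in the multivariate Lagrange inversion formula. -/
def lagMatrix (γ : ι → ℤ) (N : ι →₀ ℕ) : Matrix ι ι ℤ :=
  Matrix.of fun p r => lagEntry (if p = r then 1 else 0) (G p r) (lagVac G γ N r) (N r)

/-- The coefficients of the inverse series, as functions of the exponents `γ`. -/
def lagCoeff (γ : ι → ℤ) (N : ι →₀ ℕ) : ℤ := (lagMatrix G γ N).det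

theorem lagVac_sub_single (γ : ι → ℤ) (N : ι →₀ ℕ) (p r : ι) :
    lagVac G (γ - Pi.single p 1) N r = lagVac G γ N r - if r = p then 1 else 0 := by
  simp only [lagVac, Pi.sub_apply, Pi.single_apply]
  ring

theorem lagVac_add_single (γ : ι → ℤ) (N : ι →₀ ℕ) (p r : ι) :
    lagVac G γ (N + Finsupp.single p 1) r = lagVac G (γ - G p) N r := by
  simp only [lagVac, Pi.sub_apply, Finsupp.add_apply, Finsupp.single_apply]
  push_cast
  simp only [add_mul, Finset.sum_add_distrib]
  simp
  ring

/-- `γ p` enters only column `p`, and for `N p = 0` that column consists of constant terms `δ`,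
independent of the exponent. -/
theorem lagCoeff_sub_single_of_eq_zero (γ : ι → ℤ) (N : ι →₀ ℕ) (p : ι) (hp : N p = 0) :
    lagCoeff G (γ - Pi.single p 1) N = lagCoeff G γ N := by
  unfold lagCoeff
  congr 1
  ext q r
  simp only [lagMatrix, Matrix.of_apply, lagVac_sub_single]
  by_cases h : r = p
  · subst h; simp [hp, lagEntry]
  · simp [h]

/-- The three matrices agree outside column `p`, where `lagEntry_sub` writes the left one as the sum
of the other two; the determinant is additive in that column. -/
theorem lagCoeff_add_single (γ : ι → ℤ) (N : ι →₀ ℕ) (p : ι) :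
    lagCoeff G γ (N + Finsupp.single p 1) =
      lagCoeff G (γ - Pi.single p 1) (N + Finsupp.single p 1) + lagCoeff G (γ - G p) N := by
  unfold lagCoeff
  have h1 : lagMatrix G γ (N + Finsupp.single p 1) =
      (lagMatrix G (γ - G p) N).updateCol p
        ((fun q => lagMatrix G (γ - Pi.single p 1) (N + Finsupp.single p 1) q p) +
          fun q => lagMatrix G (γ - G p) N q p) := by
    ext q r
    simp only [Matrix.updateCol_apply]
    by_cases h : r = p
    · subst h
      simp only [if_true, Pi.add_apply, lagMatrix, Matrix.of_apply, lagVac_sub_single,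
        Finsupp.add_apply, Finsupp.single_eq_same]
      rw [lagVac_add_single, lagEntry_sub]
    · simp [h, lagMatrix, lagVac_add_single, Finsupp.single_apply, Ne.symm h]
  rw [h1, Matrix.det_updateCol_add]
  congr 2
  · ext q r
    simp only [Matrix.updateCol_apply]
    by_cases h : r = p
    · simp [h]
    · simp only [h, if_false, lagMatrix, Matrix.of_apply, lagVac_sub_single, sub_zero]
      simp [lagVac_add_single, Ne.symm h]
  · simp

theorem lagCoeff_zero (γ : ι → ℤ) : lagCoeff G γ 0 = 1 := by
  have : lagMatrix G γ 0 = 1 := by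
    ext p r
    simp [lagMatrix, lagEntry, Matrix.one_apply]
  rw [lagCoeff, this, Matrix.det_one]

theorem natCast_mul_multichoose_succ (P : ℤ) (k : ℕ) :
    ((k + 1 : ℕ) : ℤ) * Ring.multichoose P (k + 1) = P * Ring.multichoose (P + 1) k := by
  have h1 := Ring.factorial_nsmul_multichoose_eq_ascPochhammer P (k + 1)
  have h2 := Ring.factorial_nsmul_multichoose_eq_ascPochhammer (P + 1) k
  have h3 : (ascPochhammer ℕ (k + 1)).smeval P = P * (ascPochhammer ℕ k).smeval (P + 1) := by
    rw [ascPochhammer_succ_left, Polynomial.smeval_X_mul, Polynomial.smeval_comp]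
    simp
  have hk : ((k.factorial : ℕ) : ℤ) ≠ 0 := by exact_mod_cast k.factorial_ne_zero
  apply mul_left_cancel₀ hk
  rw [h3, ← h2, Nat.factorial_succ] at h1
  simp only [nsmul_eq_mul] at h1
  push_cast at h1 ⊢
  linear_combination h1

/-- A column with `N r = 0` is a unit vector, so only the block on the support of `N` matters. There
`N * multichoose P N = P * multichoose (P + 1) (N - 1)` lets a common factor be taken out of each
column. -/
theorem lagCoeff_eq_det (γ : ι → ℤ) (N : ι →₀ ℕ) :
    (lagCoeff G γ N : ℚ) =
      ((Matrix.det (Matrix.of fun p r : {p // N p ≠ 0} =>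
        (if p = r then lagVac G γ N p else 0) + G p r * N r) : ℤ) : ℚ) *
      ∏ p : {p // N p ≠ 0},
        (1 / (N p : ℚ)) * ((Ring.multichoose (lagVac G γ N p + 1) (N p - 1) : ℤ) : ℚ) := by
  have hblock : lagCoeff G γ N =
      ((lagMatrix G γ N).toSquareBlockProp fun p => N p ≠ 0).det := by
    rw [lagCoeff, Matrix.twoBlockTriangular_det' _ fun p => N p ≠ 0]
    · have : ((lagMatrix G γ N).toSquareBlockProp fun p => ¬ N p ≠ 0) = 1 := by
        ext ⟨p, hp⟩ ⟨r, hr⟩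
        rw [not_not] at hp hr
        simp [Matrix.toSquareBlockProp_def, lagMatrix, hr, lagEntry, Matrix.one_apply]
      rw [this, Matrix.det_one, mul_one]
    · intro p hp r hr
      rw [not_not] at hr
      have : p ≠ r := by rintro rfl; exact hp hr
      simp [lagMatrix, hr, lagEntry, this]
  rw [hblock, Int.cast_det, Int.cast_det, mul_comm, ← Matrix.det_mul_row]
  congr 1
  ext ⟨p, hp⟩ ⟨r, hr⟩
  obtain ⟨k, hk⟩ := Nat.exists_eq_succ_of_ne_zero hr
  have hm := natCast_mul_multichoose_succ (lagVac G γ N r) k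
  have hm' : ((k : ℚ) + 1) * ((Ring.multichoose (lagVac G γ N r) (k + 1) : ℤ) : ℚ) =
      lagVac G γ N r * ((Ring.multichoose (lagVac G γ N r + 1) k : ℤ) : ℚ) := by
    exact_mod_cast hm
  have hk0 : (k : ℚ) + 1 ≠ 0 := by positivity
  by_cases hpr : p = r
  · subst hpr
    simp only [Matrix.toSquareBlockProp_def, lagMatrix, Matrix.of_apply, Matrix.map_apply, hk,
      lagEntry, Nat.succ_eq_add_one, Nat.add_sub_cancel, if_true]
    push_cast
    field_simp
    linear_combination hm'
  · simp only [Matrix.toSquareBlockProp_def, lagMatrix, Matrix.of_apply, Matrix.map_apply, hk,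
      lagEntry, Nat.succ_eq_add_one, Nat.add_sub_cancel, hpr, Subtype.mk.injEq, if_false]
    push_cast
    field_simp
    ring

/-- For `γ = 0` the diagonal term cancels the sum of `G p r * N r` along row `p`, so the all-ones
vector is in the kernel. Symmetry is needed because `lagVac` sums over the first index of `G`. -/
theorem lagCoeff_zero_left (hG : ∀ p r, G p r = G r p) (N : ι →₀ ℕ) (hN : N ≠ 0) :
    lagCoeff G 0 N = 0 := by
  have h := lagCoeff_eq_det G 0 N
  rw [(Matrix.exists_mulVec_eq_zero_iff (M := Matrix.of fun p r : {p // N p ≠ 0} =>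
        (if p = r then lagVac G 0 N p else 0) + G p r * N r)).mp] at h
  · simpa using h
  · refine ⟨fun _ => 1, ?_, ?_⟩
    · obtain ⟨p, hp⟩ := Finsupp.ne_iff.mp hN
      exact fun h => one_ne_zero (congrFun h ⟨p, hp⟩)
    · ext p
      simp only [Matrix.mulVec, dotProduct, Matrix.of_apply, mul_one, Finset.sum_add_distrib,
        Finset.sum_ite_eq, Finset.mem_univ, if_true, Pi.zero_apply]
      have : ∑ r : {p // N p ≠ 0}, G p r * (N r : ℤ) = ∑ r, G p r * (N r : ℤ) := by
        rw [← Finset.sum_subtype (Finset.univ.filter fun p => N p ≠ 0) (by simp)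
          (fun r => G p r * (N r : ℤ)), Finset.sum_filter_of_ne]
        intro r _ h hr
        simp [hr] at h
      rw [this, lagVac, Pi.zero_apply, zero_sub, neg_add_eq_zero]
      exact Finset.sum_congr rfl fun r _ => by rw [hG, mul_comm]

/-- The generating series of the coefficients `lagCoeff`. -/
def lagSeries (γ : ι → ℤ) : MvPowerSeries ι ℂ := fun N => (lagCoeff G γ N : ℂ)

theorem coeff_lagSeries (γ : ι → ℤ) (N : ι →₀ ℕ) :
    MvPowerSeries.coeff N (lagSeries G γ) = (lagCoeff G γ N : ℂ) := rfl

theorem lagSeries_zero (hG : ∀ p r, G p r = G r p) : lagSeries G 0 = 1 := by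
  ext N
  rw [coeff_lagSeries, MvPowerSeries.coeff_one]
  split_ifs with h
  · rw [h, lagCoeff_zero, Int.cast_one]
  · rw [lagCoeff_zero_left G hG N h, Int.cast_zero]

theorem lagSeries_sub (γ : ι → ℤ) (p : ι) :
    lagSeries G γ - lagSeries G (γ - Pi.single p 1) =
      MvPowerSeries.X p * lagSeries G (γ - G p) := by
  ext N
  rw [map_sub, MvPowerSeries.X_def, MvPowerSeries.coeff_monomial_mul]
  simp only [coeff_lagSeries]
  by_cases h : N p = 0
  · rw [if_neg, lagCoeff_sub_single_of_eq_zero G γ N p h, sub_self]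
    intro hle
    have := hle p
    simp [h] at this
  · have hle : Finsupp.single p 1 ≤ N := by
      rw [Finsupp.single_le_iff]; omega
    obtain ⟨N', rfl⟩ := exists_add_of_le hle
    rw [if_pos hle, add_tsub_cancel_left, add_comm (Finsupp.single p 1) N', lagCoeff_add_single]
    push_cast
    ring

end Lagrange
end KRBethe

namespace KRBethe

/-! ### Uniqueness of solutions of the recurrence -/

section Uniqueness

variable {ι A : Type*} [Fintype ι] [DecidableEq ι] [CommRing A]

/-- The periods of `f` modulo `J` form a subgroup of the lattice; it contains the unit vectors,
hence everything. -/
theorem sub_zero_mem_of_sub_single_mem (f : (ι → ℤ) → A) (J : Ideal A)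
    (h : ∀ γ p, f γ - f (γ - Pi.single p 1) ∈ J) (γ : ι → ℤ) : f γ - f 0 ∈ J := by
  let S : AddSubgroup (ι → ℤ) :=
    { carrier := {δ | ∀ γ, f (γ + δ) - f γ ∈ J}
      zero_mem' := fun γ => by simp
      add_mem' := fun {δ ε} hδ hε γ => by
        have := J.add_mem (hε (γ + δ)) (hδ γ)
        rwa [sub_add_sub_cancel, add_assoc] at this
      neg_mem' := fun {δ} hδ γ => by
        have := J.neg_mem (hδ (γ + -δ))
        rwa [neg_sub, neg_add_cancel_right] at this }
  have hsingle : ∀ p, Pi.single p 1 ∈ S := fun p γ => by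
    have := h (γ + Pi.single p 1) p
    rwa [add_sub_cancel_right] at this
  have hγ : γ ∈ S := by
    have : γ = ∑ p, γ p • Pi.single p (1 : ℤ) := by
      funext q
      simp [Finset.sum_apply, Pi.single_apply]
    rw [this]
    exact S.sum_mem fun p _ => S.zsmul_mem (hsingle p) _
  simpa using hγ 0

/-- A family of ring elements that vanishes at `0` and satisfies the homogeneous recurrence of the
series `lagSeries` is zero, if the coefficients `w` are topologically nilpotent. -/
theorem eq_zero_of_recurrence (G : ι → ι → ℤ) (w : ι → A) (J : ℕ → Ideal A) (hJ0 : J 0 = ⊤)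
    (hJ : ∀ k p, ∀ x ∈ J k, w p * x ∈ J (k + 1)) {K : ℕ} (hK : J K = ⊥) (f : (ι → ℤ) → A)
    (h0 : f 0 = 0) (h : ∀ γ p, f γ - f (γ - Pi.single p 1) = w p * f (γ - G p)) (γ : ι → ℤ) :
    f γ = 0 := by
  -- If all values lie in `J k`, all unit differences lie in `J (k + 1)`, so `f` is constant modulo
  -- `J (k + 1)`, equal to `f 0 = 0`.
  have key : ∀ k γ, f γ ∈ J k := by
    intro k
    induction k with
    | zero => simp [hJ0]
    | succ k ih =>
      intro γ
      have := sub_zero_mem_of_sub_single_mem f (J (k + 1))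
        (fun γ p => by rw [h]; exact hJ k p _ (ih _)) γ
      rwa [h0, sub_zero] at this
  have := key K γ
  rwa [hK, Ideal.mem_bot] at this

end Uniqueness

/-! ### Summation by parts -/

section SummationByParts

theorem sum_smul_second_difference {M : Type*} [AddCommGroup M] (q : ℕ → M) (hq : q 0 = 0)
    (f : ℕ → ℤ) (hf : f 0 = 0) (K : ℕ) :
    ∑ k ∈ Finset.range K, f (k + 1) • (q (k + 2) + q k - (2 : ℤ) • q (k + 1)) =
      ∑ k ∈ Finset.range K, (f (k + 2) + f k - 2 * f (k + 1)) • q (k + 1) +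
        (f K • q (K + 1) - f (K + 1) • q K) := by
  induction K with
  | zero => simp [hf, hq]
  | succ K ih =>
    rw [Finset.sum_range_succ, Finset.sum_range_succ, ih]
    module

/-- The boundary terms cancel once both sequences are stationary at `K`. -/
theorem prod_zpow_second_difference {U : Type*} [CommGroup U] (q : ℕ → U) (hq : q 0 = 1)
    (f : ℕ → ℤ) (hf : f 0 = 0) (K : ℕ) (hqK : q (K + 1) = q K) (hfK : f (K + 1) = f K) :
    ∏ k ∈ Finset.range K, (q (k + 2) * q k / q (k + 1) ^ (2 : ℤ)) ^ f (k + 1) =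
      ∏ k ∈ Finset.range K, q (k + 1) ^ (f (k + 2) + f k - 2 * f (k + 1)) := by
  have h := sum_smul_second_difference (M := Additive U) (fun k => Additive.ofMul (q k))
    (by rw [hq]; rfl) f hf K
  rw [hqK, hfK, sub_self, add_zero] at h
  exact h

end SummationByParts

/-! ### The degree filtration on power series -/

section OrderIdeal

variable {σ : Type*}

/-- The ideal of the power series all of whose terms have degree at least `k`. -/
def orderIdeal (σ : Type*) (k : ℕ) : Ideal (MvPowerSeries σ ℂ) where
  carrier := {f | ∀ d : σ →₀ ℕ, d.degree < k → MvPowerSeries.coeff d f = 0}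
  zero_mem' := fun _ _ => by simp
  add_mem' := fun hf hg d hd => by rw [map_add, hf d hd, hg d hd, add_zero]
  smul_mem' := fun c f hf d hd => by
    classical
    rw [smul_eq_mul, MvPowerSeries.coeff_mul]
    refine Finset.sum_eq_zero fun x hx => ?_
    rw [Finset.HasAntidiagonal.mem_antidiagonal] at hx
    rw [hf x.2, mul_zero]
    rw [← hx, map_add] at hd
    omega

theorem orderIdeal_zero : orderIdeal σ 0 = ⊤ :=
  eq_top_iff.mpr fun _ _ _ hd => absurd hd (Nat.not_lt_zero _)

theorem X_pow_mem_orderIdeal (a : σ) (m : ℕ) : MvPowerSeries.X a ^ m ∈ orderIdeal σ m := by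
  classical
  intro d hd
  rw [MvPowerSeries.coeff_X_pow, if_neg]
  rintro rfl
  simp at hd

theorem orderIdeal_anti {j k : ℕ} (h : j ≤ k) : orderIdeal σ k ≤ orderIdeal σ j :=
  fun _ hf d hd => hf d (hd.trans_le h)

theorem mul_mem_orderIdeal {j k : ℕ} {f g : MvPowerSeries σ ℂ} (hf : f ∈ orderIdeal σ j)
    (hg : g ∈ orderIdeal σ k) : f * g ∈ orderIdeal σ (j + k) := by
  classical
  intro d hd
  rw [MvPowerSeries.coeff_mul]
  refine Finset.sum_eq_zero fun x hx => ?_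
  rw [Finset.HasAntidiagonal.mem_antidiagonal] at hx
  rw [← hx, map_add] at hd
  rcases lt_or_ge x.1.degree j with h | h
  · rw [hf _ h, zero_mul]
  · rw [hg _ (by omega), mul_zero]

end OrderIdeal

/-! ### The Q-system modulo high degree -/

namespace SimpleType

variable {n : ℕ} (D : SimpleType n)

theorem pairing_comm (a : Fin n) (m : ℕ) (b : Fin n) (k : ℕ) :
    D.pairing a m b k = D.pairing b k a m := by
  have h : D.form a b = D.form b a := by
    have ha : (D.t a : ℚ) ≠ 0 := by exact_mod_cast (D.t_pos a).ne'
    have hb : (D.t b : ℚ) ≠ 0 := by exact_mod_cast (D.t_pos b).ne'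
    have hs : (D.C a b : ℚ) * D.t b = D.C b a * D.t a := by exact_mod_cast D.symm a b
    rw [form, form, div_eq_div_iff ha hb, hs]
  have : (D.pairing a m b k : ℚ) = D.pairing b k a m := by
    rw [coe_pairing, coe_pairing, h, min_comm]
  exact_mod_cast this

theorem pairing_zero (a : Fin n) (m : ℕ) (b : Fin n) : D.pairing a m b 0 = 0 := by
  unfold pairing
  split_ifs with h
  · have := D.t_pos b
    rw [mul_zero, Nat.le_zero, mul_eq_zero] at h
    have : m = 0 := h.resolve_left this.ne'
    simp [this]
  · simp

theorem pairing_of_le (a : Fin n) (m : ℕ) (b : Fin n) (k : ℕ) (h : D.t b * m ≤ k) :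
    D.pairing a m b k = D.C b a * m :=
  if_pos (h.trans (Nat.le_mul_of_pos_left k (D.t_pos a)))

section Truncation

variable (M : ℕ) (Q : Fin n → ℕ → (MvPowerSeries (Fin n) ℂ)ˣ)

/-- The ring of power series modulo terms of degree `> M`. -/
abbrev Trunc (n M : ℕ) : Type := MvPowerSeries (Fin n) ℂ ⧸ orderIdeal (Fin n) (M + 1)

/-- The truncation of the series `Q_m^{(a)}`. -/
def qTrunc (a : Fin n) (m : ℕ) : (Trunc n M)ˣ :=
  Units.map (Ideal.Quotient.mk (orderIdeal (Fin n) (M + 1)) : _ →* Trunc n M) (Q a m)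

/-- The truncation of the ratio `Q_{m+1}^{(a)} Q_{m-1}^{(a)} / (Q_m^{(a)})²`, for `m = k + 1`. -/
def vTrunc (a : Fin n) (k : ℕ) : (Trunc n M)ˣ :=
  qTrunc M Q a (k + 2) * qTrunc M Q a k / qTrunc M Q a (k + 1) ^ (2 : ℤ)

variable {D Q}

theorem IsQFamily.qTrunc_zero (hQ : D.IsQFamily Q) (a : Fin n) : qTrunc M Q a 0 = 1 := by
  rw [qTrunc, hQ.zero, map_one]

theorem IsQFamily.exists_qTrunc_eq (hQ : D.IsQFamily Q) :
    ∃ K₀, ∀ K ≥ K₀, ∀ a, qTrunc M Q a (K + 1) = qTrunc M Q a K := by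
  have hfin : {d : Fin n →₀ ℕ | d.degree < M + 1}.Finite := by
    refine (Finsupp.finite_of_degree_le M).subset fun d hd => ?_
    exact Nat.lt_succ_iff.mp hd
  have h : ∀ᶠ K : ℕ in atTop, ∀ a, qTrunc M Q a (K + 1) = qTrunc M Q a K := by
    refine eventually_all.mpr fun a => ?_
    obtain ⟨L, hL⟩ := hQ.conv a
    have h1 := (hfin.eventually_all (l := atTop)
      (p := fun d (m : ℕ) => MvPowerSeries.coeff d (Q a m : MvPowerSeries (Fin n) ℂ) =
        MvPowerSeries.coeff d L)).mpr fun d _ => hL d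
    filter_upwards [h1, (tendsto_add_atTop_nat 1).eventually h1] with K h2 h3
    refine Units.ext (Ideal.Quotient.eq.mpr fun d hd => ?_)
    rw [map_sub, sub_eq_zero]
    exact (h3 d hd).trans (h2 d hd).symm
  exact eventually_atTop.mp h

/-- The Q-system divided by the unit `(Q_m)²`, with `m = k + 1`. -/
theorem IsQFamily.coe_vTrunc (hQ : D.IsQFamily Q) (a : Fin n) (k : ℕ) :
    (vTrunc M Q a k : Trunc n M) =
      1 - Ideal.Quotient.mk _ (MvPowerSeries.X a ^ (k + 1)) *
        ((∏ᶠ p : H n, qTrunc M Q p.1 p.2 ^ (-(D.expB a (k + 1) p.1 p.2)) : (Trunc n M)ˣ) :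
          Trunc n M) := by
  have hrel := congrArg (Ideal.Quotient.mk (orderIdeal (Fin n) (M + 1)))
    (hQ.rel a (k + 1) (Nat.succ_pos k))
  have hsupp : (Function.mulSupport fun p : H n =>
      Q p.1 p.2 ^ (-(D.expB a (k + 1) p.1 p.2))).Finite := by
    refine (D.finite_expB a (k + 1)).subset fun p hp => ?_
    rw [Function.mem_mulSupport] at hp
    intro h0
    rw [h0, neg_zero, zpow_zero] at hp
    exact hp rfl
  have hprod : (∏ᶠ p : H n, qTrunc M Q p.1 p.2 ^ (-(D.expB a (k + 1) p.1 p.2)) : (Trunc n M)ˣ) =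
      Units.map (Ideal.Quotient.mk (orderIdeal (Fin n) (M + 1)) : _ →* Trunc n M)
        (∏ᶠ p : H n, Q p.1 p.2 ^ (-(D.expB a (k + 1) p.1 p.2))) := by
    have h := MonoidHom.map_finprod (N := (Trunc n M)ˣ) (Units.map
      ((Ideal.Quotient.mk (orderIdeal (Fin n) (M + 1)) : _ →+* Trunc n M) : _ →* Trunc n M)) hsupp
    refine Eq.trans (finprod_congr fun p => ?_) h.symm
    rw [map_zpow]
    rfl
  have hv : (vTrunc M Q a k : Trunc n M) * (qTrunc M Q a (k + 1) : Trunc n M) ^ 2 =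
      qTrunc M Q a (k + 2) * qTrunc M Q a k := by
    rw [← Units.val_pow_eq_pow_val, ← Units.val_mul, ← Units.val_mul, vTrunc, ← zpow_natCast]
    simp
  rw [hprod]
  have hu : IsUnit ((qTrunc M Q a (k + 1) : Trunc n M) ^ 2) :=
    (qTrunc M Q a (k + 1)).isUnit.pow 2
  apply hu.mul_right_cancel
  rw [hv]
  simp only [map_add, map_mul, map_pow] at hrel ⊢
  change (qTrunc M Q a (k + 1) : Trunc n M) ^ 2 = (qTrunc M Q a (k + 2) : Trunc n M) *
    (qTrunc M Q a k : Trunc n M) + _ * (qTrunc M Q a (k + 1) : Trunc n M) ^ 2 * _ at hrel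
  rw [Units.coe_map]
  simp only [MonoidHom.coe_coe]
  linear_combination -hrel

theorem IsQFamily.vTrunc_of_le (hQ : D.IsQFamily Q) (a : Fin n) (k : ℕ) (hk : M ≤ k) :
    vTrunc M Q a k = 1 := by
  refine Units.ext ?_
  rw [hQ.coe_vTrunc, Ideal.Quotient.eq_zero_iff_mem.mpr, zero_mul, sub_zero, Units.val_one]
  exact orderIdeal_anti (by omega) (X_pow_mem_orderIdeal a (k + 1))

theorem IsQFamily.prod_vTrunc (hQ : D.IsQFamily Q) (b : Fin n) (f : ℕ → ℤ) (hf : f 0 = 0)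
    (K₁ : ℕ) (hfK : ∀ k ≥ K₁, f (k + 1) = f k) :
    ∃ K₀, ∀ K ≥ K₀, ∏ k ∈ Finset.range K,
        qTrunc M Q b (k + 1) ^ (f (k + 2) + f k - 2 * f (k + 1)) =
      ∏ k : Fin M, vTrunc M Q b k ^ f (k + 1) := by
  obtain ⟨K₀, hK₀⟩ := hQ.exists_qTrunc_eq M
  -- Beyond `K₀` the truncated `Q` is stationary, beyond `K₁` so is `f`, and beyond `M` the factors
  -- `v` are `1`.
  refine ⟨max (max K₀ K₁) M, fun K hK => ?_⟩
  rw [ge_iff_le, max_le_iff, max_le_iff] at hK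
  rw [← prod_zpow_second_difference (qTrunc M Q b) (hQ.qTrunc_zero M b) f hf K
    (hK₀ K hK.1.1 b) (hfK K hK.1.2),
    ← Finset.prod_range (fun k => vTrunc M Q b k ^ f (k + 1))]
  symm
  refine Finset.prod_subset (Finset.range_subset_range.mpr hK.2) fun k _ hk => ?_
  rw [Finset.mem_range, not_lt] at hk
  rw [hQ.vTrunc_of_le M b k hk, one_zpow]

/-- The second difference of `-min(m, ·)` is the delta function at `m`, so summation by parts
isolates `Q_m`. -/
theorem IsQFamily.qTrunc_eq_prod (hQ : D.IsQFamily Q) (a : Fin n) (m : ℕ) :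
    qTrunc M Q a m = ∏ k : Fin M, vTrunc M Q a k ^ (-((min m (k + 1) : ℕ) : ℤ)) := by
  rcases m with _ | m
  · simp [hQ.qTrunc_zero]
  obtain ⟨K₀, hK₀⟩ := hQ.prod_vTrunc M a (fun k => -((min (m + 1) k : ℕ) : ℤ)) (by simp) (m + 1)
    (fun k hk => by congr 2; omega)
  rw [← hK₀ (max K₀ (m + 1)) (le_max_left _ _), Finset.prod_eq_single m]
  · have : (-((min (m + 1) (m + 2) : ℕ) : ℤ) + -((min (m + 1) m : ℕ) : ℤ) -
        2 * -((min (m + 1) (m + 1) : ℕ) : ℤ)) = 1 := by omega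
    rw [this, zpow_one]
  · intro k _ hk
    have : (-((min (m + 1) (k + 2) : ℕ) : ℤ) + -((min (m + 1) k : ℕ) : ℤ) -
        2 * -((min (m + 1) (k + 1) : ℕ) : ℤ)) = 0 := by omega
    rw [this, zpow_zero]
  · intro h
    exact absurd (Finset.mem_range.mpr (by omega)) h

/-- Summation by parts again: `-expB` is the second difference of the pairing in `k`, which is
constant for `k ≥ t_b m`. -/
theorem IsQFamily.finprod_qTrunc (hQ : D.IsQFamily Q) (a : Fin n) (m : ℕ) :
    (∏ᶠ p : H n, qTrunc M Q p.1 p.2 ^ (-(D.expB a m p.1 p.2)) : (Trunc n M)ˣ) =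
      ∏ r : Fin n × Fin M, vTrunc M Q r.1 r.2 ^ D.pairing a m r.1 (r.2 + 1) := by
  have h1 : ∀ b : Fin n, ∃ K₀, ∀ K ≥ K₀, ∏ k ∈ Finset.range K,
      qTrunc M Q b (k + 1) ^ (-(D.expB a m b (k + 1))) =
        ∏ k : Fin M, vTrunc M Q b k ^ D.pairing a m b (k + 1) := by
    intro b
    obtain ⟨K₀, hK₀⟩ := hQ.prod_vTrunc M b (D.pairing a m b) (D.pairing_zero a m b) (D.t b * m)
      (fun k hk => by rw [D.pairing_of_le a m b _ hk, D.pairing_of_le a m b _ (by omega)])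
    refine ⟨K₀, fun K hK => ?_⟩
    rw [← hK₀ K hK]
    refine Finset.prod_congr rfl fun k _ => ?_
    congr 1
    simp only [expB, Nat.add_sub_cancel]
    ring
  choose K₀ hK₀ using h1
  -- The bound `t_b m + 1` ensures that for an index beyond `K` even `k - 1` lies where the pairing
  -- is constant, so `expB` vanishes.
  let K := (Finset.univ.sup fun b => max (K₀ b) (D.t b * m + 1))
  have hK : ∀ b, K₀ b ≤ K ∧ D.t b * m + 1 ≤ K := fun b => by
    rw [← max_le_iff]
    exact Finset.le_sup (f := fun b => max (K₀ b) (D.t b * m + 1)) (Finset.mem_univ b)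
  let e : ℕ ↪ ℕ+ := ⟨Nat.succPNat, Nat.succPNat_injective⟩
  rw [finprod_eq_prod_of_mulSupport_subset _
    (s := (Finset.univ : Finset (Fin n)) ×ˢ (Finset.range K).map e), Finset.prod_product,
    Fintype.prod_prod_type]
  · refine Finset.prod_congr rfl fun b _ => ?_
    rw [Finset.prod_map, ← hK₀ b K (hK b).1]
    rfl
  · rintro ⟨b, k⟩ hk
    rw [Function.mem_mulSupport] at hk
    rw [Finset.mem_coe, Finset.mem_product, Finset.mem_map]
    refine ⟨Finset.mem_univ _, k.natPred, ?_, PNat.succPNat_natPred k⟩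
    rw [Finset.mem_range]
    by_contra hc
    apply hk
    have h3 := PNat.natPred_add_one k
    have h4 := (hK b).2
    have : D.expB a m b k = 0 := by
      rw [expB, D.pairing_of_le a m b _ (by omega), D.pairing_of_le a m b _ (by omega),
        D.pairing_of_le a m b _ (by omega)]
      ring
    simp only [this, neg_zero, zpow_zero]

end Truncation

end SimpleType
end KRBethe

namespace KRBethe
namespace SimpleType

variable {n : ℕ} (D : SimpleType n)

/-! ### The numbers `R(ν, N)` as Lagrange coefficients -/

section Inversion

variable (M : ℕ)

/-- The embedding of the indices `(a, m)` with `m ≤ M` into `H`. -/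
def truncEmb (n M : ℕ) : Fin n × Fin M ↪ H n where
  toFun r := (r.1, Nat.succPNat r.2)
  inj' r s h := by
    rw [Prod.mk.injEq] at h
    exact Prod.ext h.1 (Fin.ext (Nat.succPNat_injective h.2))

/-- The matrix `(α_a | α_b) min (t_b m, t_a k)` on the indices with `m, k ≤ M`. -/
def truncPairing (p r : Fin n × Fin M) : ℤ := D.pairing p.1 (p.2 + 1) r.1 (r.2 + 1)

theorem truncPairing_comm (p r : Fin n × Fin M) : D.truncPairing M p r = D.truncPairing M r p :=
  D.pairing_comm ..

/-- The numbers `γ_m^{(a)}(ν)` with `m ≤ M`. -/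
def truncGam (ν : NN n) (r : Fin n × Fin M) : ℤ := gam ν (truncEmb n M r)

theorem vac_embDomain (ν : NN n) (N : Fin n × Fin M →₀ ℕ) (p : Fin n × Fin M) :
    D.vac ν (N.embDomain (truncEmb n M)) (truncEmb n M p) =
      lagVac (D.truncPairing M) (truncGam M ν) N p := by
  rw [vac, lagVac, truncGam, Finsupp.sum_embDomain, Finsupp.sum_fintype _ _ (by simp)]
  congr 1
  refine Finset.sum_congr rfl fun s _ => ?_
  rw [D.truncPairing_comm, mul_comm]
  rfl

theorem R_embDomain (ν : NN n) (N : Fin n × Fin M →₀ ℕ) :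
    D.R ν (N.embDomain (truncEmb n M)) = lagCoeff (D.truncPairing M) (truncGam M ν) N := by
  by_cases hN : N = 0
  · rw [hN, Finsupp.embDomain_zero, R, if_pos rfl, lagCoeff_zero, Int.cast_one]
  have hN' : N.embDomain (truncEmb n M) ≠ 0 := by
    rwa [Ne, Finsupp.embDomain_eq_zero]
  let E : {p // N p ≠ 0} ≃ (N.embDomain (truncEmb n M)).support :=
    Equiv.ofBijective
      (fun p => ⟨truncEmb n M p, by
        rw [Finsupp.support_embDomain]
        exact Finset.mem_map_of_mem _ (Finsupp.mem_support_iff.mpr p.2)⟩)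
      ⟨fun p r h => Subtype.ext ((truncEmb n M).injective (congrArg Subtype.val h)), by
        rintro ⟨p, hp⟩
        rw [Finsupp.support_embDomain, Finset.mem_map] at hp
        obtain ⟨q, hq, rfl⟩ := hp
        exact ⟨⟨q, Finsupp.mem_support_iff.mp hq⟩, rfl⟩⟩
  rw [R, if_neg hN', lagCoeff_eq_det, ← Matrix.det_submatrix_equiv_self E, ← Finset.prod_coe_sort,
    ← E.prod_comp]
  congr 2
  · congr 1
    ext p r
    have hE : ∀ q, (E q : H n) = truncEmb n M q := fun _ => rfl
    simp only [Matrix.submatrix_apply, Matrix.of_apply, F, hE, Finsupp.embDomain_apply_self,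
      vac_embDomain, (truncEmb n M).injective.eq_iff, Subtype.ext_iff]
    rfl
  · funext p
    have hE : (E p : H n) = truncEmb n M p := rfl
    have hp := p.2
    simp only [hE, Finsupp.embDomain_apply_self, vac_embDomain]
    -- `multichoose (P + 1) (N - 1)` is `choose (P + N - 1) (N - 1)`; the natural subtraction is
    -- genuine since `N p ≠ 0`.
    rw [Ring.multichoose_eq]
    congr 4
    push_cast [Nat.one_le_iff_ne_zero.mpr hp]
    ring

theorem prod_X_pow (N : Fin n × Fin M →₀ ℕ) :
    (N.prod fun s e => ((MvPowerSeries.X s.1 : MvPowerSeries (Fin n) ℂ) ^ ((s.2 : ℕ) + 1)) ^ e) =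
      MvPowerSeries.monomial (content (N.embDomain (truncEmb n M))) 1 := by
  rw [content, Finsupp.sum_embDomain, Finsupp.sum, Finsupp.prod]
  have h : ∀ (s : Finset (Fin n × Fin M)) (f : Fin n × Fin M → Fin n →₀ ℕ),
      (MvPowerSeries.monomial (∑ i ∈ s, f i) (1 : ℂ)) =
        ∏ i ∈ s, MvPowerSeries.monomial (f i) (1 : ℂ) := fun s f => by
    simpa using (MvPowerSeries.prod_monomial f (fun _ => (1 : ℂ)) s).symm
  rw [h]
  refine Finset.prod_congr rfl fun s _ => ?_
  rw [← pow_mul, MvPowerSeries.X_pow_eq]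
  rfl

theorem hasSubst_X_pow : MvPowerSeries.HasSubst fun p : Fin n × Fin M =>
    (MvPowerSeries.X p.1 : MvPowerSeries (Fin n) ℂ) ^ ((p.2 : ℕ) + 1) :=
  MvPowerSeries.hasSubst_of_constantCoeff_zero fun p => by simp

/-- Each `m` in the support contributes at least `m` to the degree of `d`, so `m ≤ M`. -/
theorem mem_range_embDomain {N : NN n} {d : Fin n →₀ ℕ} (hN : content N = d)
    (hd : d.degree ≤ M) : ∃ N' : Fin n × Fin M →₀ ℕ, N'.embDomain (truncEmb n M) = N := by
  rw [← Set.mem_range, Finsupp.mem_range_embDomain_iff]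
  intro p hp
  have hp0 : N p ≠ 0 := Finsupp.mem_support_iff.mp hp
  have h1 : (p.2 : ℕ) * N p ≤ d p.1 := by
    have h := Finset.single_le_sum
      (f := fun r : H n => (Finsupp.single r.1 ((r.2 : ℕ) * N r)) p.1)
      (fun _ _ => Nat.zero_le _) hp
    rw [← hN, content, Finsupp.sum, Finsupp.finsetSum_apply]
    simpa using h
  have h2 : d p.1 ≤ d.degree := Finsupp.le_degree _ _
  have h3 : (p.2 : ℕ) ≤ (p.2 : ℕ) * N p := Nat.le_mul_of_pos_right _ (Nat.pos_of_ne_zero hp0)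
  have h4 := PNat.natPred_add_one p.2
  refine ⟨(p.1, ⟨p.2.natPred, by omega⟩), ?_⟩
  exact Prod.ext rfl (PNat.succPNat_natPred p.2)

/-- Up to degree `M`, `R̃^ν` is the Lagrange series with its variable of index `(a, m)` specialized
to `y_a^m`. -/
theorem coeff_Rtilde_eq (ν : NN n) (d : Fin n →₀ ℕ) (hd : d.degree ≤ M) :
    MvPowerSeries.coeff d (D.Rtilde ν) =
      MvPowerSeries.coeff d (MvPowerSeries.substAlgHom (R := ℂ) (hasSubst_X_pow M)
        (lagSeries (D.truncPairing M) (truncGam M ν))) := by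
  rw [MvPowerSeries.substAlgHom_apply, MvPowerSeries.coeff_subst (hasSubst_X_pow M)]
  have himg : {N : NN n | content N = d} = (Finsupp.embDomain (truncEmb n M)) ''
      {N : Fin n × Fin M →₀ ℕ | content (N.embDomain (truncEmb n M)) = d} := by
    ext N
    constructor
    · intro hN
      obtain ⟨N', rfl⟩ := mem_range_embDomain M hN hd
      exact ⟨N', hN, rfl⟩
    · rintro ⟨N', hN', rfl⟩
      exact hN'
  change ∑ᶠ N ∈ {N : NN n | content N = d}, ((D.R ν N : ℚ) : ℂ) = _
  rw [himg, finsum_mem_image (Finsupp.embDomain_injective _).injOn, finsum_mem_def]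
  refine finsum_congr fun N => ?_
  rw [prod_X_pow, MvPowerSeries.coeff_monomial, coeff_lagSeries, Set.indicator_apply]
  simp only [R_embDomain, Set.mem_ofPred_eq, eq_comm (a := d), smul_eq_mul, mul_ite, mul_one,
    mul_zero]
  simp

end Inversion

/-! ### The product formula for the Q-series -/

section QProduct

variable {D} (M : ℕ) {Q : Fin n → ℕ → (MvPowerSeries (Fin n) ℂ)ˣ}

/-- The product `∏_{(a,m)} v_m^{(a)} ^ (-γ_m^{(a)})`. -/
def vProd (M : ℕ) (Q : Fin n → ℕ → (MvPowerSeries (Fin n) ℂ)ˣ) (γ : Fin n × Fin M → ℤ) :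
    (Trunc n M)ˣ :=
  ∏ r, vTrunc M Q r.1 r.2 ^ (-γ r)

theorem IsQFamily.prod_qTrunc (hQ : D.IsQFamily Q) (ν : NN n) :
    ∏ p ∈ ν.support, qTrunc M Q p.1 p.2 ^ ν p = vProd M Q (truncGam M ν) := by
  have h : ∀ p : H n, qTrunc M Q p.1 p.2 ^ ν p = ∏ r : Fin n × Fin M, vTrunc M Q r.1 r.2 ^
      (-(if p.1 = r.1 then ((min ((r.2 : ℕ) + 1) (p.2 : ℕ) : ℕ) : ℤ) * ν p else 0)) := by
    intro p
    rw [hQ.qTrunc_eq_prod M, Fintype.prod_prod_type, Finset.prod_eq_single p.1, ← Finset.prod_pow]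
    · refine Finset.prod_congr rfl fun k _ => ?_
      rw [if_pos rfl, ← zpow_natCast, ← zpow_mul, neg_mul, min_comm]
    · intro b _ hb
      simp [Ne.symm hb]
    · simp
  rw [Finset.prod_congr rfl fun p _ => h p, Finset.prod_comm, vProd]
  refine Finset.prod_congr rfl fun r _ => ?_
  have hsum : ∀ (s : Finset (H n)) (u : (Trunc n M)ˣ) (f : H n → ℤ),
      ∏ p ∈ s, u ^ f p = u ^ ∑ p ∈ s, f p := fun s u f => by
    classical
    induction s using Finset.induction_on with
    | empty => simp
    | insert p s hp ih => rw [Finset.prod_insert hp, Finset.sum_insert hp, ih, zpow_add]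
  rw [hsum, Finset.sum_neg_distrib]
  rfl

theorem vProd_sub (γ δ : Fin n × Fin M → ℤ) :
    vProd M Q (γ - δ) = vProd M Q γ * ∏ r, vTrunc M Q r.1 r.2 ^ δ r := by
  rw [vProd, vProd, ← Finset.prod_mul_distrib]
  refine Finset.prod_congr rfl fun r _ => ?_
  rw [← zpow_add, Pi.sub_apply, neg_sub', sub_neg_eq_add]

/-- The left side is `vProd γ * (1 - v_p)`, and the Q-system evaluates `1 - v_p`. -/
theorem IsQFamily.vProd_sub_single (hQ : D.IsQFamily Q) (γ : Fin n × Fin M → ℤ)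
    (p : Fin n × Fin M) :
    (vProd M Q γ : Trunc n M) - (vProd M Q (γ - Pi.single p 1) : Trunc n M) =
      Ideal.Quotient.mk _ (MvPowerSeries.X p.1 ^ ((p.2 : ℕ) + 1)) *
        (vProd M Q (γ - D.truncPairing M p) : Trunc n M) := by
  have h1 : ∏ r : Fin n × Fin M, vTrunc M Q r.1 r.2 ^ (Pi.single p 1 : Fin n × Fin M → ℤ) r =
      vTrunc M Q p.1 p.2 := by
    rw [Finset.prod_eq_single p]
    · simp
    · intro r _ hr
      simp [hr]
    · simp
  rw [vProd_sub, vProd_sub, h1, Units.val_mul, Units.val_mul, hQ.coe_vTrunc, hQ.finprod_qTrunc]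
  simp only [truncPairing]
  ring

theorem IsQFamily.vProd_eq (hQ : D.IsQFamily Q) (γ : Fin n × Fin M → ℤ) :
    (vProd M Q γ : Trunc n M) = Ideal.Quotient.mk _ (MvPowerSeries.substAlgHom (R := ℂ)
      (hasSubst_X_pow M) (lagSeries (D.truncPairing M) γ)) := by
  rw [← sub_eq_zero]
  -- The difference of the two sides solves the homogeneous recurrence. The ideals are the images of
  -- the degree filtration, which vanish at `k = M + 1`; each weight has degree `m ≥ 1`, so it
  -- raises the filtration.
  refine eq_zero_of_recurrence (D.truncPairing M)
    (fun p => Ideal.Quotient.mk _ (MvPowerSeries.X p.1 ^ ((p.2 : ℕ) + 1)))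
    (fun k => (orderIdeal (Fin n) k).map (Ideal.Quotient.mk (orderIdeal (Fin n) (M + 1))))
    (by rw [orderIdeal_zero, Ideal.map_top]) (fun k p x hx => ?_) (Ideal.map_quotient_self _)
    (fun γ => (vProd M Q γ : Trunc n M) - Ideal.Quotient.mk _ (MvPowerSeries.substAlgHom (R := ℂ)
      (hasSubst_X_pow M) (lagSeries (D.truncPairing M) γ))) ?_ (fun γ p => ?_) γ
  · obtain ⟨f, hf, rfl⟩ := (Ideal.mem_map_iff_of_surjective _ Ideal.Quotient.mk_surjective).mp hx
    rw [← map_mul]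
    refine Ideal.mem_map_of_mem _ (orderIdeal_anti ?_
      (mul_mem_orderIdeal (X_pow_mem_orderIdeal p.1 ((p.2 : ℕ) + 1)) hf))
    omega
  · rw [lagSeries_zero _ (D.truncPairing_comm M), map_one, map_one]
    simp [vProd]
  · have h1 := hQ.vProd_sub_single M γ p
    have h2 := congrArg (fun f => Ideal.Quotient.mk (orderIdeal (Fin n) (M + 1))
      (MvPowerSeries.substAlgHom (R := ℂ) (hasSubst_X_pow M) f))
      (lagSeries_sub (D.truncPairing M) γ p)
    simp only [map_sub, map_mul, MvPowerSeries.substAlgHom_X] at h2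
    linear_combination h1 - h2

/-- The product formula `∏ (Q̃_m^{(a)}) ^ ν_m^{(a)} = R̃^ν`. -/
theorem IsQFamily.prod_eq_Rtilde (hQ : D.IsQFamily Q) (ν : NN n) :
    ∏ p ∈ ν.support, (Q p.1 p.2 : MvPowerSeries (Fin n) ℂ) ^ ν p = D.Rtilde ν := by
  ext d
  have h := (congrArg Units.val (hQ.prod_qTrunc d.degree ν)).trans (hQ.vProd_eq d.degree _)
  rw [Units.coe_prod] at h
  simp only [Units.val_pow_eq_pow_val] at h
  have h2 : Ideal.Quotient.mk (orderIdeal (Fin n) (d.degree + 1))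
      (∏ p ∈ ν.support, (Q p.1 p.2 : MvPowerSeries (Fin n) ℂ) ^ ν p) =
      Ideal.Quotient.mk _ (MvPowerSeries.substAlgHom (R := ℂ)
      (hasSubst_X_pow d.degree) (lagSeries (D.truncPairing d.degree) (truncGam d.degree ν))) := by
    rw [← h, map_prod]
    simp only [map_pow]
    rfl
  rw [D.coeff_Rtilde_eq d.degree ν d le_rfl, ← sub_eq_zero, ← map_sub]
  exact Ideal.Quotient.eq.mp h2 d (Nat.lt_succ_self _)

end QProduct

end SimpleType
end KRBethe

/-! ### Weight spaces and weight bases -/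

namespace KRBethe

theorem qpow_zero (hbar : ℂ) : qpow hbar 0 = 1 := by rw [qpow, mul_zero, Complex.exp_zero]

theorem qpow_add (hbar s s' : ℂ) : qpow hbar (s + s') = qpow hbar s * qpow hbar s' := by
  rw [qpow, mul_add, Complex.exp_add]; rfl

theorem qpow_sum {κ : Type*} (hbar : ℂ) (s : Finset κ) (f : κ → ℂ) :
    qpow hbar (∑ i ∈ s, f i) = ∏ i ∈ s, qpow hbar (f i) := by
  simp only [qpow, Finset.mul_sum, Complex.exp_sum]

theorem qpow_zpow (hbar s : ℂ) (k : ℤ) : qpow hbar s ^ k = qpow hbar (k * s) := by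
  rw [qpow, qpow, ← Complex.exp_int_mul]; congr 1; ring

namespace SimpleType

variable {n : ℕ} (D : SimpleType n) (hbar : ℂ)

theorem qpow_div_injective (hq : ∀ k : ℕ, 0 < k → qpow hbar 1 ^ k ≠ 1) (i : Fin n) :
    Function.Injective fun l : ℤ => qpow hbar ((l : ℂ) / (D.t i : ℂ)) := by
  have ht : (D.t i : ℂ) ≠ 0 := by exact_mod_cast (D.t_pos i).ne'
  have hq' : ∀ k : ℤ, qpow hbar k = 1 → k = 0 := by
    intro k hk
    rw [← mul_one (k : ℂ), ← qpow_zpow] at hk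
    by_contra h0
    refine hq k.natAbs (Int.natAbs_pos.mpr h0) ?_
    rcases Int.natAbs_eq k with h | h <;> rw [h] at hk
    · rwa [zpow_natCast] at hk
    · rwa [zpow_neg, zpow_natCast, inv_eq_one] at hk
  intro l l' h
  have h1 : ∀ l : ℤ, qpow hbar ((l : ℂ) / (D.t i : ℂ)) ^ (D.t i : ℤ) = qpow hbar l := by
    intro l
    rw [qpow_zpow]
    congr 1
    push_cast
    field_simp
  have h2 : qpow hbar l = qpow hbar l' := by rw [← h1, ← h1]; exact congrArg (· ^ _) h
  have h3 := hq' (l - l') (by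
    rw [Int.cast_sub, sub_eq_add_neg, qpow_add, h2, ← qpow_add, ← sub_eq_add_neg, sub_self,
      qpow_zero])
  omega

section Basis

variable {V κ : Type*} [AddCommGroup V] [Module ℂ V] {K : Fin n → Module.End ℂ V}

theorem mem_weightSpace {lam : Weight n} {v : V} :
    v ∈ D.weightSpace hbar K lam ↔
      ∀ i, K i v = qpow hbar ((lam i : ℂ) / (D.t i : ℂ)) • v := by
  simp [weightSpace, Submodule.mem_iInf]

/-- In the basis `b` every `K i` is diagonal, and distinct weights differ in some eigenvalue, so a
weight vector has no coordinates at other weights. -/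
theorem weightSpace_eq_span (hq : ∀ k : ℕ, 0 < k → qpow hbar 1 ^ k ≠ 1)
    (b : Module.Basis κ ℂ V) (wt : κ → Weight n)
    (hb : ∀ j, b j ∈ D.weightSpace hbar K (wt j)) (lam : Weight n) :
    D.weightSpace hbar K lam = Submodule.span ℂ (b '' {j | wt j = lam}) := by
  apply le_antisymm
  · intro v hv
    rw [b.mem_span_image]
    intro j hj
    rw [Finset.mem_coe, Finsupp.mem_support_iff] at hj
    have hrepr : ∀ i, b.repr (K i v) j =
        qpow hbar ((wt j i : ℂ) / (D.t i : ℂ)) * b.repr v j := by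
      intro i
      have hlin : (b.coord j).comp (K i) =
          qpow hbar ((wt j i : ℂ) / (D.t i : ℂ)) • b.coord j := by
        refine b.ext fun l => ?_
        have := (D.mem_weightSpace hbar).mp (hb l) i
        rw [LinearMap.comp_apply, this, LinearMap.smul_apply, map_smul]
        by_cases hl : l = j
        · rw [hl]
        · simp [hl]
      exact LinearMap.congr_fun hlin v
    funext i
    apply D.qpow_div_injective hbar hq i
    apply mul_right_cancel₀ hj
    rw [← hrepr, (D.mem_weightSpace hbar).mp hv i, map_smul]
    rfl
  · rw [Submodule.span_le]
    rintro _ ⟨j, rfl, rfl⟩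
    exact hb j

theorem weightMult_eq_card [Fintype κ] (hq : ∀ k : ℕ, 0 < k → qpow hbar 1 ^ k ≠ 1)
    (b : Module.Basis κ ℂ V) (wt : κ → Weight n)
    (hb : ∀ j, b j ∈ D.weightSpace hbar K (wt j)) (lam : Weight n) :
    D.weightMult hbar K lam = (Finset.univ.filter fun j => wt j = lam).card := by
  classical
  rw [weightMult, D.weightSpace_eq_span hbar hq b wt hb, Set.image_eq_range,
    finrank_span_eq_card (b := fun j : {j | wt j = lam} => b j)
      (b.linearIndependent.comp _ Subtype.val_injective)]
  exact Fintype.card_subtype _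

end Basis

section Tensor

variable {ι : Type*} [Fintype ι] {V κ : ι → Type*} [∀ i, AddCommGroup (V i)]
  [∀ i, Module ℂ (V i)]

theorem tprod_mem_weightSpace {K : ∀ j, Fin n → Module.End ℂ (V j)} {v : ∀ j, V j}
    {lam : ι → Weight n} (hv : ∀ j, v j ∈ D.weightSpace hbar (K j) (lam j)) :
    PiTensorProduct.tprod ℂ v ∈
      D.weightSpace hbar (fun i => PiTensorProduct.map fun j => K j i) (∑ j, lam j) := by
  rw [mem_weightSpace]
  intro i
  rw [PiTensorProduct.map_tprod]
  have h : (fun j => K j i (v j)) =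
      fun j => qpow hbar ((lam j i : ℂ) / (D.t i : ℂ)) • v j :=
    funext fun j => (D.mem_weightSpace hbar).mp (hv j) i
  rw [h, MultilinearMap.map_smul_univ, ← qpow_sum, Finset.sum_apply, Int.cast_sum,
    Finset.sum_div]

end Tensor

section Affine

variable {V : Type*} [AddCommGroup V] [Module ℂ V] [Module (D.QAffine hbar) V]
  [IsScalarTower ℂ (D.QAffine hbar) V]

theorem cls_eq {f g : FreeGen n} (h : D.Rel hbar f g) : D.cls hbar f = D.cls hbar g :=
  RingQuot.mkAlgHom_rel ℂ h

theorem mem_weightSpace_kAct {lam : Weight n} {v : V} :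
    v ∈ D.weightSpace hbar (D.kAct hbar V) lam ↔ ∀ i,
      D.cls hbar (FreeGen.k true i) • v = qpow hbar ((lam i : ℂ) / (D.t i : ℂ)) • v :=
  D.mem_weightSpace hbar

theorem smul_mem_weightSpace_of_commute {lam : Weight n} {v : V}
    (hv : v ∈ D.weightSpace hbar (D.kAct hbar V) lam) (g : FreeGen n)
    (hg : ∀ i, D.cls hbar (FreeGen.k true i * g) = D.cls hbar (g * FreeGen.k true i)) :
    D.cls hbar g • v ∈ D.weightSpace hbar (D.kAct hbar V) lam := by
  rw [mem_weightSpace_kAct] at hv ⊢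
  intro i
  rw [← mul_smul, ← map_mul, hg, map_mul, mul_smul, hv, smul_comm]

theorem cls_k_false_mul (i : Fin n) :
    D.cls hbar (FreeGen.k false i) * D.cls hbar (FreeGen.k true i) = 1 := by
  have := D.cls_eq hbar (Rel.k_inv (hbar := hbar) false i)
  rwa [map_mul, map_one] at this

theorem cls_k_true_mul (i : Fin n) :
    D.cls hbar (FreeGen.k true i) * D.cls hbar (FreeGen.k false i) = 1 := by
  have := D.cls_eq hbar (Rel.k_inv (hbar := hbar) true i)
  rwa [map_mul, map_one] at this

theorem x_smul_mem_weightSpace {lam : Weight n} {v : V}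
    (hv : v ∈ D.weightSpace hbar (D.kAct hbar V) lam) (s : Bool) (j : Fin n) (r : ℤ) :
    D.cls hbar (FreeGen.x s j r) • v ∈
      D.weightSpace hbar (D.kAct hbar V) (lam + sgn s • D.root j) := by
  rw [mem_weightSpace_kAct] at hv ⊢
  intro i
  have h := D.cls_eq hbar (Rel.k_x (hbar := hbar) i s j r)
  rw [map_mul, map_mul, map_smul] at h
  have h' : D.cls hbar (FreeGen.k true i) * D.cls hbar (FreeGen.x s j r) =
      D.qi hbar i ^ (sgn s * D.C i j) •
        (D.cls hbar (FreeGen.x s j r) * D.cls hbar (FreeGen.k true i)) := by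
    rw [← smul_mul_assoc, ← h, mul_assoc, cls_k_false_mul, mul_one]
  have hc : D.cls hbar (FreeGen.x s j r) • qpow hbar ((lam i : ℂ) / (D.t i : ℂ)) • v =
      qpow hbar ((lam i : ℂ) / (D.t i : ℂ)) • D.cls hbar (FreeGen.x s j r) • v := smul_comm _ _ _
  rw [← mul_smul, h', smul_assoc, mul_smul, hv, hc, smul_smul, qi, qpow_zpow, ← qpow_add]
  congr 2
  simp [root]
  ring

/-- The sum of all weight spaces. -/
def weightSum (V : Type*) [AddCommGroup V] [Module ℂ V] [Module (D.QAffine hbar) V]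
    [IsScalarTower ℂ (D.QAffine hbar) V] : Submodule ℂ V :=
  ⨆ lam, D.weightSpace hbar (D.kAct hbar V) lam

/-- The `x` generators shift the weight by a simple root up to sign; all others commute with the
`k_i`. -/
theorem gen_smul_mem_weightSpace {lam : Weight n} {v : V}
    (hv : v ∈ D.weightSpace hbar (D.kAct hbar V) lam) (g : Gen n) :
    ∃ mu, D.cls hbar (FreeAlgebra.ι ℂ g) • v ∈ D.weightSpace hbar (D.kAct hbar V) mu := by
  rcases g with ⟨s, j, r⟩ | ⟨s, j, m⟩ | ⟨s, j⟩ | s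
  · exact ⟨_, D.x_smul_mem_weightSpace hbar hv s j r⟩
  · exact ⟨lam, D.smul_mem_weightSpace_of_commute hbar hv (FreeGen.h s j m)
      fun i => D.cls_eq hbar (Rel.k_h i s j m)⟩
  · refine ⟨lam, D.smul_mem_weightSpace_of_commute hbar hv (FreeGen.k s j) fun i => ?_⟩
    have hk : Commute (D.cls hbar (FreeGen.k true i)) (D.cls hbar (FreeGen.k true j)) := by
      have := D.cls_eq hbar (Rel.k_k (hbar := hbar) i j)
      rwa [map_mul, map_mul] at this
    rw [map_mul, map_mul]
    cases s with
    | true => exact hk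
    | false =>
      let u : (D.QAffine hbar)ˣ := ⟨D.cls hbar (FreeGen.k true j), D.cls hbar (FreeGen.k false j),
        D.cls_k_true_mul hbar j, D.cls_k_false_mul hbar j⟩
      exact Commute.units_inv_right (u := u) hk
  · exact ⟨lam, D.smul_mem_weightSpace_of_commute hbar hv (FreeGen.c s)
      fun i => (D.cls_eq hbar (Rel.c_central s (Gen.k true i))).symm⟩

theorem smul_mem_weightSum (x : D.QAffine hbar) {v : V} (hv : v ∈ D.weightSum hbar V) :
    x • v ∈ D.weightSum hbar V := by
  obtain ⟨f, rfl⟩ := RingQuot.mkAlgHom_surjective ℂ (D.Rel hbar) x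
  change D.cls hbar f • v ∈ _
  induction f using FreeAlgebra.induction generalizing v with
  | grade0 r =>
    rw [AlgHom.commutes, algebraMap_smul]
    exact Submodule.smul_mem _ _ hv
  | grade1 g =>
    have hle : D.weightSum hbar V ≤ (D.weightSum hbar V).comap
        (Algebra.lsmul ℂ ℂ V (D.cls hbar (FreeAlgebra.ι ℂ g))) := by
      refine iSup_le fun lam w hw => ?_
      obtain ⟨mu, hmu⟩ := D.gen_smul_mem_weightSpace hbar hw g
      exact Submodule.mem_iSup_of_mem mu hmu
    exact hle hv
  | mul f g hf hg =>
    rw [map_mul, mul_smul]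
    exact hf (hg hv)
  | add f g hf hg =>
    rw [map_add, add_smul]
    exact Submodule.add_mem _ (hf hv) (hg hv)

theorem phi_zero (s : Bool) (i : Fin n) : D.phi hbar s i 0 = FreeGen.k s i := by
  simp [phi]

/-- The sum of the weight spaces is a submodule containing the highest weight vector, so
irreducibility makes it everything. -/
theorem HasDrinfeldPolynomials.weightSum_eq_top {P : Fin n → Polynomial ℂ}
    (hV : D.HasDrinfeldPolynomials hbar V P) (hP : ∀ b, (P b).coeff 0 = 1) :
    D.weightSum hbar V = ⊤ := by
  obtain ⟨v, hv0, -, -, ψ, hψ, hψt, -⟩ := hV.exists_vector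
  have hv : v ∈ D.weightSpace hbar (D.kAct hbar V) fun b => ((P b).natDegree : ℤ) := by
    rw [mem_weightSpace_kAct]
    intro i
    have h1 := hψ true i 0
    -- As `P_i(0) = 1`, the constant term of `ψ^+_i` is `q_i ^ deg P_i`: this is the eigenvalue of
    -- `k_i = φ^+_{i,0}`.
    have h2 := congrArg (PowerSeries.coeff 0) (hψt i)
    simp only [PowerSeries.coeff_mul, Finset.HasAntidiagonal.antidiagonal_zero,
      Finset.sum_singleton, map_smul, Polynomial.coeff_coe, Polynomial.coeff_zero_eq_eval_zero,
      Polynomial.eval_comp, Polynomial.eval_mul, Polynomial.eval_C, Polynomial.eval_X, mul_zero]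
      at h2
    rw [← Polynomial.coeff_zero_eq_eval_zero, hP, mul_one, smul_eq_mul, mul_one] at h2
    rw [phi_zero, h2] at h1
    rw [h1, qi, ← zpow_natCast, qpow_zpow]
    congr 2
    ring
  let S : Submodule (D.QAffine hbar) V :=
    { (D.weightSum hbar V).toAddSubmonoid with
      smul_mem' := fun x _ hw => D.smul_mem_weightSum hbar x hw }
  have hvS : v ∈ S := Submodule.mem_iSup_of_mem _ hv
  have := hV.irreducible
  have hS : S = ⊤ := (eq_bot_or_eq_top S).resolve_left fun h => by
    rw [h, Submodule.mem_bot] at hvS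
    exact hv0 hvS
  rw [eq_top_iff]
  intro w _
  have : w ∈ S := hS ▸ Submodule.mem_top
  exact this

theorem coeff_zero_krPoly (a : Fin n) (m : ℕ) (u : ℂ) (b : Fin n) :
    (D.krPoly hbar a m u b).coeff 0 = 1 := by
  unfold krPoly
  split_ifs
  · rw [Polynomial.coeff_zero_eq_eval_zero, Polynomial.eval_prod]
    simp
  · simp

theorem IsKRModule.exists_weight_basis {a : Fin n} {m : ℕ} {u : ℂ}
    (hV : D.IsKRModule hbar V a m u) :
    ∃ (κ : Type) (_ : Fintype κ) (b : Module.Basis κ ℂ V) (wt : κ → Weight n),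
      ∀ j, b j ∈ D.weightSpace hbar (D.kAct hbar V) (wt j) := by
  have htop := HasDrinfeldPolynomials.weightSum_eq_top D hbar hV
    (D.coeff_zero_krPoly hbar a m u)
  have hspan : ⊤ ≤ Submodule.span ℂ
      {v : V | ∃ lam, v ∈ D.weightSpace hbar (D.kAct hbar V) lam} := by
    rw [← htop]
    exact iSup_le fun lam w hw => Submodule.subset_span ⟨lam, hw⟩
  have := hV.finite
  let b := Module.Basis.ofSpan hspan
  have hb : ∀ j, ∃ lam, b j ∈ D.weightSpace hbar (D.kAct hbar V) lam := fun j =>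
    Module.Basis.ofSpan_subset hspan ⟨j, rfl⟩
  have := Module.Finite.finite_basis b
  choose wt hwt using hb
  -- Reindexing by `Fin` places the index type in `Type`, whatever the universe of `V`.
  refine ⟨_, inferInstance, b.reindex (Finite.equivFin _),
    fun j => wt ((Finite.equivFin _).symm j), fun j => ?_⟩
  rw [Module.Basis.reindex_apply]
  exact hwt _

end Affine

end SimpleType
end KRBethe

namespace KRBethe
namespace SimpleType

variable {n : ℕ} (D : SimpleType n)

/-! ### Characters as sums of monomials -/

section Laurent

theorem setOf_sub_eq (μ : Weight n) (d : Fin n →₀ ℕ) :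
    {e : Fin n →₀ ℕ | μ - ∑ a, e a • D.root a = μ - ∑ a, d a • D.root a} = {d} := by
  ext e
  rw [Set.mem_ofPred_eq, Set.mem_singleton_iff, sub_right_inj]
  exact ⟨D.root_injective e d, fun h => by rw [h]⟩

theorem laurent_sub (μ : Weight n) (f : MvPowerSeries (Fin n) ℂ) (d : Fin n →₀ ℕ) :
    D.laurent μ f (μ - ∑ a, d a • D.root a) = MvPowerSeries.coeff d f := by
  rw [laurent, D.setOf_sub_eq, finsum_mem_singleton]

theorem laurent_eq_zero (μ : Weight n) (f : MvPowerSeries (Fin n) ℂ) (lam : Weight n)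
    (h : ∀ d : Fin n →₀ ℕ, μ - ∑ a, d a • D.root a ≠ lam) : D.laurent μ f lam = 0 := by
  have : {d : Fin n →₀ ℕ | μ - ∑ a, d a • D.root a = lam} = ∅ :=
    Set.eq_empty_of_forall_notMem h
  rw [laurent, this, finsum_mem_empty]

variable {κ : Type*} [Fintype κ]

theorem laurent_sum_monomial (μ : Weight n) (d : κ → Fin n →₀ ℕ) (lam : Weight n) :
    D.laurent μ (∑ j, MvPowerSeries.monomial (d j) 1) lam =
      ((Finset.univ.filter fun j => μ - ∑ a, d j a • D.root a = lam).card : ℂ) := by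
  classical
  by_cases h : ∃ e : Fin n →₀ ℕ, μ - ∑ a, e a • D.root a = lam
  · obtain ⟨e, rfl⟩ := h
    rw [D.laurent_sub, map_sum, Finset.card_filter]
    push_cast
    refine Finset.sum_congr rfl fun j _ => ?_
    rw [MvPowerSeries.coeff_monomial]
    refine if_congr ?_ rfl rfl
    rw [sub_right_inj]
    exact ⟨fun h => by rw [h], fun h => (D.root_injective _ _ h).symm⟩
  · push Not at h
    rw [D.laurent_eq_zero μ _ lam h, Finset.filter_eq_empty_iff.mpr fun j _ => h (d j)]
    simp

/-- A weight that occurs has nonzero multiplicity, hence lies in `μ` minus the root cone, since the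
Laurent coefficients vanish elsewhere. Independence of the roots then recovers `f` from its Laurent
coefficients. -/
theorem exists_sum_monomial (μ : Weight n) (f : MvPowerSeries (Fin n) ℂ) (wt : κ → Weight n)
    (h : ∀ lam, ((Finset.univ.filter fun j => wt j = lam).card : ℂ) = D.laurent μ f lam) :
    ∃ d : κ → Fin n →₀ ℕ, (∀ j, μ - ∑ a, d j a • D.root a = wt j) ∧
      f = ∑ j, MvPowerSeries.monomial (d j) 1 := by
  have hd : ∀ j, ∃ d : Fin n →₀ ℕ, μ - ∑ a, d a • D.root a = wt j := by
    intro j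
    by_contra! hc
    have h1 := h (wt j)
    rw [D.laurent_eq_zero μ f _ hc, Nat.cast_eq_zero, Finset.card_eq_zero] at h1
    exact Finset.filter_eq_empty_iff.mp h1 (Finset.mem_univ j) rfl
  choose d hd using hd
  refine ⟨d, hd, ?_⟩
  ext e
  rw [← D.laurent_sub μ f, ← D.laurent_sub μ, D.laurent_sum_monomial, ← h]
  simp only [hd]

end Laurent

/-! ### Characters of tensor products and weight multiplicities -/

theorem sum_single_eq_topWeight (ν : NN n) :
    ∑ j : (Σ p : ν.support, Fin (ν p)), (Pi.single j.1.1.1 ((j.1.1.2 : ℕ) : ℤ) : Weight n) =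
      topWeight ν := by
  rw [Fintype.sum_sigma, Finset.sum_coe_sort ν.support
    (fun p : H n => ∑ _ : Fin (ν p), (Pi.single p.1 ((p.2 : ℕ) : ℤ) : Weight n))]
  funext a
  rw [topWeight, content, Finsupp.sum, Finsupp.finsetSum_apply, Finset.sum_apply]
  push_cast
  refine Finset.sum_congr rfl fun p _ => ?_
  by_cases h : a = p.1
  · subst h; simp [mul_comm]
  · simp [h]

theorem prod_sigma_eq {A : Type*} [CommMonoid A] (ν : NN n) (q : H n → A) :
    ∏ j : (Σ p : ν.support, Fin (ν p)), q j.1.1 = ∏ p ∈ ν.support, q p ^ ν p := by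
  rw [Fintype.prod_sigma]
  simp only [Finset.prod_const, Finset.card_univ, Fintype.card_fin]
  exact Finset.prod_coe_sort ν.support fun p => q p ^ ν p

theorem Rx_eq_finsum_R (ν : NN n) (lam : Weight n) :
    D.Rx ν lam = ((∑ᶠ N ∈ D.NNset ν lam, D.R ν N : ℚ) : ℂ) := by
  by_cases h : ∃ d : Fin n →₀ ℕ, topWeight ν - ∑ a, d a • D.root a = lam
  · obtain ⟨d, rfl⟩ := h
    have hset : D.NNset ν (topWeight ν - ∑ a, d a • D.root a) = {N | content N = d} := by
      ext N
      exact Set.ext_iff.mp (D.setOf_sub_eq (topWeight ν) d) (content N)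
    rw [Rx, D.laurent_sub, hset]
    exact (AddMonoidHom.map_finsum_mem _ (Rat.castHom ℂ).toAddMonoidHom (finite_content d)).symm
  · push Not at h
    have hset : D.NNset ν lam = ∅ := Set.eq_empty_of_forall_notMem fun N => h (content N)
    rw [Rx, D.laurent_eq_zero _ _ lam h, hset, finsum_mem_empty, Rat.cast_zero]

theorem character_kActTensor (hbar : ℂ) (hq : ∀ k : ℕ, 0 < k → qpow hbar 1 ^ k ≠ 1)
    (W : Fin n → ℕ+ → Type*) [∀ a m, AddCommGroup (W a m)] [∀ a m, Module ℂ (W a m)]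
    [∀ a m, Module (D.QAffine hbar) (W a m)]
    [∀ a m, IsScalarTower ℂ (D.QAffine hbar) (W a m)]
    (u : Fin n → ℕ+ → ℂ) (hW : ∀ a m, D.IsKRModule hbar (W a m) a m (u a m))
    (f : H n → MvPowerSeries (Fin n) ℂ)
    (hf : ∀ p : H n, D.character hbar (D.kAct hbar (W p.1 p.2)) =
      D.laurent (Pi.single p.1 (p.2 : ℤ)) (f p)) (ν : NN n) :
    D.character hbar (D.kActTensor hbar W ν) =
      D.laurent (topWeight ν) (∏ p ∈ ν.support, f p ^ ν p) := by
  classical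
  choose κ hκ b wt hb using fun p : H n => IsKRModule.exists_weight_basis D hbar (hW p.1 p.2)
  have hd := fun p : H n => D.exists_sum_monomial (Pi.single p.1 (p.2 : ℤ)) (f p) (wt p)
    (fun lam => by
      rw [← hf, character, D.weightMult_eq_card hbar hq (b p) (wt p) (hb p)])
  choose d hdw hdf using hd
  let J := Σ p : ν.support, Fin (ν p)
  let B := Basis.piTensorProduct fun j : J => b j.1.1
  have hB : ∀ k, B k ∈ D.weightSpace hbar (D.kActTensor hbar W ν) (∑ j : J, wt j.1.1 (k j)) := by
    intro k
    rw [Basis.piTensorProduct_apply]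
    exact D.tprod_mem_weightSpace hbar (K := fun j : J => D.kAct hbar (W j.1.1.1 j.1.1.2))
      fun j => hb j.1.1 (k j)
  -- Expanding the product of sums gives one monomial for each choice of a basis vector in every
  -- factor, matching the tensor basis.
  have hprod : ∏ p ∈ ν.support, f p ^ ν p =
      ∑ k : (∀ j : J, κ j.1.1), MvPowerSeries.monomial (∑ j : J, d j.1.1 (k j)) 1 := by
    rw [← prod_sigma_eq, Finset.prod_congr rfl fun (j : J) _ => hdf j.1.1, Finset.prod_univ_sum,
      Fintype.piFinset_univ]
    refine Finset.sum_congr rfl fun k _ => ?_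
    rw [MvPowerSeries.prod_monomial, Finset.prod_const_one]
  funext lam
  rw [hprod, D.laurent_sum_monomial, character, D.weightMult_eq_card hbar hq B _ hB]
  congr 2
  refine Finset.filter_congr fun k _ => ?_
  have hw : ∑ j : J, wt j.1.1 (k j) =
      topWeight ν - ∑ a, (∑ j : J, d j.1.1 (k j)) a • D.root a := by
    rw [← sum_single_eq_topWeight, Finset.sum_congr rfl fun (j : J) _ => (hdw j.1.1 (k j)).symm,
      Finset.sum_sub_distrib, Finset.sum_comm]
    congr 1
    refine Finset.sum_congr rfl fun a _ => ?_
    rw [Finsupp.finsetSum_apply, Finset.sum_smul]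
  rw [hw]

end SimpleType
end KRBethe

end

theorem corollary4p7 {n : ℕ} (D : KRBethe.SimpleType n)
    -- `q = exp ℏ` is not a root of unity
    (hbar : ℂ) (hq : ∀ k : ℕ, 0 < k → KRBethe.qpow hbar 1 ^ k ≠ 1)
    -- the KR modules `W_m^{(a)}(u_{a,m})`, `(a, m) ∈ H`
    (W : Fin n → ℕ+ → Type*) [∀ a m, AddCommGroup (W a m)] [∀ a m, Module ℂ (W a m)]
    [∀ a m, Module (D.QAffine hbar) (W a m)]
    [∀ a m, IsScalarTower ℂ (D.QAffine hbar) (W a m)]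
    (u : Fin n → ℕ+ → ℂ) (hW : ∀ a m, D.IsKRModule hbar (W a m) a m (u a m))
    -- the conjecture `ch W_m^{(a)} = Q_m^{(a)}`, where `Q_m^{(a)}(x) = x_a^m Q̃_m^{(a)}(y(x))`
    (Q : Fin n → ℕ → (MvPowerSeries (Fin n) ℂ)ˣ) (hQ : D.IsQFamily Q)
    (hconj : ∀ (a : Fin n) (m : ℕ+),
      D.character hbar (D.kAct hbar (W a m)) =
        D.laurent (Pi.single a (m : ℤ)) (Q a m : MvPowerSeries (Fin n) ℂ))
    (ν : KRBethe.NN n) :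
    D.character hbar (D.kActTensor hbar W ν) = D.Rx ν ∧
      ∀ lam : KRBethe.Weight n,
        (D.weightMult hbar (D.kActTensor hbar W ν) lam : ℚ) =
          ∑ᶠ N ∈ D.NNset ν lam, D.R ν N := by
  have h : D.character hbar (D.kActTensor hbar W ν) = D.Rx ν := by
    rw [D.character_kActTensor hbar hq W u hW (fun p => (Q p.1 p.2 : MvPowerSeries (Fin n) ℂ))
      (fun p => hconj p.1 p.2) ν, hQ.prod_eq_Rtilde ν]
    rfl
  refine ⟨h, fun lam => ?_⟩
  have h2 := (congrFun h lam).trans (D.Rx_eq_finsum_R ν lam)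
  rw [KRBethe.SimpleType.character] at h2
  exact_mod_cast h2
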